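/- **Embeddings with dimension conditions.** Let $X=(X,d)$ be a metric space with positive complete Borel measures $\mu$ and $\nu$, let $E\subset X$ be totally bounded and $\nu$-measurable with $\nu(E)>0$, and let $1\le p<\infty$, $\alpha>0$, $r_0>0$, $\lambda\ge1$, $s>0$. Write $B(x,r)$ for open balls, $u_{B,\mu}=\frac1{\mu(B)}\int_B u\,d\mu$. Assume that there are constants $C,C',C'',\delta,\sigma>0$ with $\sigma>s-\alpha p$ such that for all $x\in E$ and $0<r'<r\le r_0$: 1. $0<\mu(B(x,2r))\le C\mu(B(x,r))<\infty$ and $0<\nu(B(x,2r))\le C\nu(B(x,r))<\infty$; 2. $\nu(B(x,r'))/\nu(B(x,r))\le C(r'/r)^{\delta}$; 3. $\mu(B(x,r))\ge C'r^{s}$; 4. $\nu(B(x,r))\le C''r^{\sigma}$. Let $P^{\alpha,p}_{\lambda,E}(X,\mu)$ be the set of all $u$ that are $\mu$-integrable on every ball of $X$ and for which there is a nonnegative $g\in L^p(X,\mu)$ such that $$\frac1{\mu(B)}\int_{B}|u-u_{B,\mu}|\,d\mu\le r^\alpha\Bigl(\frac1{\mu(\lambda B)}\int_{\lambda B}g^p\,d\mu\Bigr)^{1/p}\qquad(*)$$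 for all balls $B=B(x,r)$ with $x\in E$ and $0<r\le r_0$, where $\lambda B=B(x,\lambda r)$. Let $Y\subset P^{\alpha,p}_{\lambda,E}(X,\mu)$ be any subset (not necessarily linear), and for each $u\in Y$ let $G(u)\in L^p(X,\mu)$ be nonnegative and such that $(*)$ holds with $g=G(u)$. Put $\bar u(x)=\limsup_{r\to0}\frac1{\mu(B(x,r))}\int_{B(x,r)}u\,d\mu$ for $x\in E$, and equip $Y$ with one of the norms $$\|\bar u\|_{L^1(E,\nu)}+\|G(u)\|_{L^p(X,\mu)}\quad\text{or}\quad\|u\|_{L^1(X,\mu)}+\|G(u)\|_{L^p(X,\mu)},$$ assumed finite on $Y$. The embedding of $Y$ into $L^q(E,\nu)$ is the map $u\mapsto\bar u$: that it is bounded means that $\bar u\in L^q(E,\nu)$ for all $u\in Y$ and $\|\bar u\|_{L^q(E,\nu)}$ is at most a constant (independent of $u$) times the norm of $u$; that it is compact means that $\bar u\in L^q(E,\nu)$ for all $u\in Y$ and that for every sequence in $Y$ that is bounded in the chosen norm, the image sequence has a subsequence converging in $L^q(E,\nu)$. (In both cases it is part of the claim that $\bar u$ is finite $\nu$-a.e.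 in $E$.) Then for every real $q>p$: (i) The embedding of $Y$ into $L^q(E,\nu)$ is compact whenever $q(s-\alpha p)<\sigma p$. (ii) Suppose that $Y$ has the truncation property: there is a constant $K$ such that for all $u\in Y$ and all real $l<k$ the inequality $(*)$, with $r^\alpha$ replaced by $Kr^\alpha$, holds for all balls $B=B(x,r)$ as above with $u$ replaced by $\max\{l,\min\{u,k\}\}$ and $g$ replaced by $G(u)\chi_{\{l<u<k\}}$. Then the embedding of $Y$ into $L^q(E,\nu)$ is bounded whenever $q(s-\alpha p)\le\sigma p$. When $\nu=\mu$, condition 4 (and with it $\sigma$) is not needed: under conditions 1–3 with $\nu=\mu$, the embedding of $Y$ into $L^q(E,\mu)$ is compact whenever $q>p$ and $q(s-\alpha p)<sp$, and, under the truncation property, bounded whenever $q>p$ and $q(s-\alpha p)\le sp$. -/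

import Mathlib

open MeasureTheory Filter Topology Metric Set
open scoped ENNReal NNReal

noncomputable section

/-- Local doubling of `μ` on `E`: with some `C > 0`, for all `x ∈ E` and `0 < r ≤ r₀`,
`0 < μ(B(x,2r)) ≤ C μ(B(x,r)) < ∞`. -/
def LocallyDoublingOn {X : Type*} [MetricSpace X] [MeasurableSpace X]
    (μ : Measure X) (E : Set X) (r₀ : ℝ) : Prop :=
  ∃ C : ℝ, 0 < C ∧ ∀ x ∈ E, ∀ r : ℝ, 0 < r → r ≤ r₀ →
    0 < μ (ball x (2 * r)) ∧ μ (ball x (2 * r)) ≤ ENNReal.ofReal C * μ (ball x r) ∧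
      ENNReal.ofReal C * μ (ball x r) < ∞

/-- With some `C, δ > 0`, for all `x ∈ E` and `0 < r' < r ≤ r₀`,
`ν(B(x,r')) / ν(B(x,r)) ≤ C (r'/r)^δ`. -/
def RatioBoundOn {X : Type*} [MetricSpace X] [MeasurableSpace X]
    (ν : Measure X) (E : Set X) (r₀ : ℝ) : Prop :=
  ∃ C δ : ℝ, 0 < C ∧ 0 < δ ∧ ∀ x ∈ E, ∀ r' r : ℝ, 0 < r' → r' < r → r ≤ r₀ →
    ν.real (ball x r') / ν.real (ball x r) ≤ C * (r' / r) ^ δ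

/-- With some `C' > 0`, `μ(B(x,r)) ≥ C' r^s` for all `x ∈ E` and `0 < r ≤ r₀`. -/
def LowerMassBoundOn {X : Type*} [MetricSpace X] [MeasurableSpace X]
    (μ : Measure X) (E : Set X) (r₀ s : ℝ) : Prop :=
  ∃ C' : ℝ, 0 < C' ∧ ∀ x ∈ E, ∀ r : ℝ, 0 < r → r ≤ r₀ →
    ENNReal.ofReal (C' * r ^ s) ≤ μ (ball x r)

/-- With some `C'' > 0`, `ν(B(x,r)) ≤ C'' r^σ` for all `x ∈ E` and `0 < r ≤ r₀`. -/
def UpperMassBoundOn {X : Type*} [MetricSpace X] [MeasurableSpace X]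
    (ν : Measure X) (E : Set X) (r₀ σ : ℝ) : Prop :=
  ∃ C'' : ℝ, 0 < C'' ∧ ∀ x ∈ E, ∀ r : ℝ, 0 < r → r ≤ r₀ →
    ν (ball x r) ≤ ENNReal.ofReal (C'' * r ^ σ)

/-- The `p`-Poincaré inequality with constant `K`, exponent `α` and dilation `τ` for the pair
`(u, g)`, on all balls centred in `E` and of radius at most `r₀`. -/
def PoincareIneqOn {X : Type*} [MetricSpace X] [MeasurableSpace X]
    (μ : Measure X) (E : Set X) (α p τ r₀ K : ℝ) (u g : X → ℝ) : Prop :=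
  ∀ x ∈ E, ∀ r : ℝ, 0 < r → r ≤ r₀ →
    (⨍ y in ball x r, |u y - ⨍ z in ball x r, u z ∂μ| ∂μ) ≤
      K * r ^ α * (⨍ y in ball x (τ * r), g y ^ p ∂μ) ^ (1 / p)

/-- `g` is an admissible gradient for `u`: a nonnegative function in `L^p(X, μ)` for which the
`p`-Poincaré inequality (with constant `1`) holds. -/
def IsPoincareGradient {X : Type*} [MetricSpace X] [MeasurableSpace X]
    (μ : Measure X) (E : Set X) (α p τ r₀ : ℝ) (u g : X → ℝ) : Prop :=
  0 ≤ᵐ[μ] g ∧ MemLp g (ENNReal.ofReal p) μ ∧ PoincareIneqOn μ E α p τ r₀ 1 u g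

/-- The `E`-restricted Poincaré Sobolev space `P^{α,p}_{τ,E}(X, μ)`. The first clause is
`u ∈ L¹_loc(X, μ)`, that is, `u` is integrable on every ball of `X`. -/
def poincareSobolev {X : Type*} [MetricSpace X] [MeasurableSpace X]
    (μ : Measure X) (E : Set X) (α p τ r₀ : ℝ) : Set (X → ℝ) :=
  {u | (∀ (x : X) (r : ℝ), IntegrableOn u (ball x r) μ) ∧
    (∀ x ∈ E, ∀ r : ℝ, 0 < r → r ≤ r₀ → 0 < μ (ball x r) ∧ μ (ball x r) < ∞) ∧
    ∃ g : X → ℝ, IsPoincareGradient μ E α p τ r₀ u g}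

/-- The precise representative `x ↦ limsup_{r → 0} ⨍_{B(x,r)} u dμ`, with values in
`[-∞, ∞]`. -/
def preciseRepE {X : Type*} [MetricSpace X] [MeasurableSpace X]
    (μ : Measure X) (u : X → ℝ) (x : X) : EReal :=
  limsup (fun r : ℝ => ((⨍ y in ball x r, u y ∂μ : ℝ) : EReal)) (𝓝[>] (0 : ℝ))

/-- The real-valued version of `preciseRepE` (set to `0` where that is infinite). -/
def preciseRep {X : Type*} [MetricSpace X] [MeasurableSpace X]
    (μ : Measure X) (u : X → ℝ) (x : X) : ℝ :=
  (preciseRepE μ u x).toReal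

/-- The norm `‖u‖_{L¹(E,ν)} + ‖G(u)‖_{L^p(X,μ)}`; on `E`, the function `u` is understood as
its precise representative. -/
def normOnE {X : Type*} [MetricSpace X] [MeasurableSpace X]
    (μ ν : Measure X) (E : Set X) (p : ℝ) (G : (X → ℝ) → (X → ℝ)) (u : X → ℝ) : ℝ≥0∞ :=
  eLpNorm (preciseRep μ u) 1 (ν.restrict E) + eLpNorm (G u) (ENNReal.ofReal p) μ

/-- The norm `‖u‖_{L¹(X,μ)} + ‖G(u)‖_{L^p(X,μ)}`. -/
def normOnX {X : Type*} [MetricSpace X] [MeasurableSpace X]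
    (μ : Measure X) (p : ℝ) (G : (X → ℝ) → (X → ℝ)) (u : X → ℝ) : ℝ≥0∞ :=
  eLpNorm u 1 μ + eLpNorm (G u) (ENNReal.ofReal p) μ

/-- The functions in `Y`, with gradients `G(u)`, satisfy the truncation property: the Poincaré
inequality holds, with one constant `K`, for the pairs `max{l, min{u,k}}`, `G(u) χ_{l<u<k}`,
for all `u ∈ Y` and `l < k`. -/
def TruncationProperty {X : Type*} [MetricSpace X] [MeasurableSpace X]
    (μ : Measure X) (E : Set X) (α p τ r₀ : ℝ) (Y : Set (X → ℝ))
    (G : (X → ℝ) → (X → ℝ)) : Prop :=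
  ∃ K : ℝ, ∀ u ∈ Y, ∀ l k : ℝ, l < k →
    PoincareIneqOn μ E α p τ r₀ K (fun x => max l (min (u x) k))
      ({x | l < u x ∧ u x < k}.indicator (G u))

/-- `Y` is mapped into `L^q(E, ν)` by `u ↦ preciseRepE μ u`: the representative is finite
`ν`-a.e. in `E` and belongs to `L^q(E, ν)`. -/
def EmbedsIn {X : Type*} [MetricSpace X] [MeasurableSpace X]
    (μ ν : Measure X) (E : Set X) (q : ℝ) (Y : Set (X → ℝ)) : Prop :=
  ∀ u ∈ Y, (∀ᵐ x ∂(ν.restrict E), preciseRepE μ u x ≠ ⊥ ∧ preciseRepE μ u x ≠ ⊤) ∧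
    MemLp (preciseRep μ u) (ENNReal.ofReal q) (ν.restrict E)

/-- The embedding of `Y`, equipped with the norm `N`, into `L^q(E, ν)` is bounded. -/
def BoundedEmbedding {X : Type*} [MetricSpace X] [MeasurableSpace X]
    (μ ν : Measure X) (E : Set X) (q : ℝ) (Y : Set (X → ℝ)) (N : (X → ℝ) → ℝ≥0∞) : Prop :=
  EmbedsIn μ ν E q Y ∧
    ∃ C : ℝ≥0, ∀ u ∈ Y,
      eLpNorm (preciseRep μ u) (ENNReal.ofReal q) (ν.restrict E) ≤ C * N u

/-- The embedding of `Y`, equipped with the norm `N`, into `L^q(E, ν)` is compact: the image of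
every bounded sequence from `Y` has a subsequence converging in `L^q(E, ν)`. -/
def CompactEmbedding {X : Type*} [MetricSpace X] [MeasurableSpace X]
    (μ ν : Measure X) (E : Set X) (q : ℝ) (Y : Set (X → ℝ)) (N : (X → ℝ) → ℝ≥0∞) : Prop :=
  EmbedsIn μ ν E q Y ∧
    ∀ f : ℕ → X → ℝ, (∀ n, f n ∈ Y) → (∃ M : ℝ≥0, ∀ n, N (f n) ≤ M) →
      ∃ φ : ℕ → ℕ, StrictMono φ ∧ ∃ v : X → ℝ,
        MemLp v (ENNReal.ofReal q) (ν.restrict E) ∧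
        Tendsto (fun n => eLpNorm (fun x => preciseRep μ (f (φ n)) x - v x)
          (ENNReal.ofReal q) (ν.restrict E)) atTop (𝓝 0)

end

/-! Let `m` be the measure |G(u)|^p dμ and Φ_r(x) = r^α (m(B(x,λr))/μ(B(x,r)))^{1/p}, which is
`fracAvg`. The Poincaré inequality bounds the mean oscillation of u on B(x,r) by Φ_r(x). Telescoping
over the radii ρ/2^j (`exists_isLebesgueValue`) shows that wherever Σ_j Φ_{ρ/2^j}(x) is finite, x is
a Lebesgue point of u, and the average over B(x,ρ/2^n) differs from ū(x) by at most a constant times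
the tail of this sum. Everything thus reduces to estimates for these sums in L^q(E,ν). The mass
bounds combine into a balance ν(B) ≤ A r^β μ(B)^{q/p} with β = σ − sq/p, whence ν(B) Φ_r^q ≤ A
r^{αq+β} m(λB)^{q/p}. Here αq+β = (σp − q(s−αp))/p, so its sign says on which side of the critical
exponent q lies. For ν = μ the lower mass bound alone gives the balance with σ replaced by s. Below
the critical exponent there is room for a slightly larger q₁ and a gain ε > 0. The maximal function
M = sup_j 2^{jε} Φ_{ρ/2^j} is of weak type q₁ by a Vitali covering
(`MassBalanceOn.measure_lt_dyadicMax_le`), hence of strong type q because ν(E) is finite. The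
telescoping tail from n on is at most C 2^{-nε} M, so ū is approximated in L^q by averages at scale
ρ/2^n, uniformly on bounded subsets of Y. Since E is totally bounded, finitely many bounded averages
suffice at each scale; this yields total boundedness in L^q
(`SubcriticalSetting.totallyBounded_range`). At the critical exponent the gain disappears. A Hedberg
type argument, using the decay of ν on shrinking balls, still gives a weak type estimate for the
whole sum (`MassBalanceOn.exists_measure_lt_tsum_fracAvg_le`). Maz'ya's truncation method upgrades
it: the weak estimate is applied to the truncations of u between consecutive dyadic levels, whose
gradients live on disjoint sets, and the pieces add up because q/p ≥ 1
(`SubcriticalSetting.exists_tsum_measure_lt_le`). In both cases averages over balls of one fixed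
radius must be controlled by the chosen norm, which is `MeanBoundOn`. -/

section Averages

variable {X : Type*} [MeasurableSpace X]

/-! ### Averages -/

theorem setAverage_le_mul_setAverage {μ : Measure X} {A B : Set X} {f : X → ℝ} {D : ℝ≥0}
    (hAB : A ⊆ B) (hf : ∀ x, 0 ≤ f x) (hfi : IntegrableOn f B μ) (hD : μ B ≤ D * μ A)
    (hA : μ A ≠ 0) (hB : μ B ≠ ∞) :
    (⨍ y in A, f y ∂μ) ≤ D * ⨍ y in B, f y ∂μ := by
  have hA' : μ A ≠ ∞ := ne_top_of_le_ne_top hB (measure_mono hAB)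
  have hB0 : μ B ≠ 0 := fun h => hA (measure_mono_null hAB h)
  have hAr : 0 < μ.real A := ENNReal.toReal_pos hA hA'
  have hBr : 0 < μ.real B := ENNReal.toReal_pos hB0 hB
  have hDr : μ.real B ≤ D * μ.real A := by
    have := ENNReal.toReal_mono (ENNReal.mul_ne_top ENNReal.coe_ne_top hA') hD
    simpa [Measure.real] using this
  have hint : ∫ y in A, f y ∂μ ≤ ∫ y in B, f y ∂μ :=
    setIntegral_mono_set hfi (Eventually.of_forall hf) (LE.le.eventuallyLE hAB)
  have hint0 : 0 ≤ ∫ y in B, f y ∂μ := integral_nonneg hf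
  rw [setAverage_eq, setAverage_eq, smul_eq_mul, smul_eq_mul]
  calc (μ.real A)⁻¹ * ∫ y in A, f y ∂μ ≤ (μ.real A)⁻¹ * ∫ y in B, f y ∂μ := by gcongr
    _ ≤ (D * (μ.real B)⁻¹) * ∫ y in B, f y ∂μ := by
        gcongr
        rw [inv_le_iff_one_le_mul₀ hAr, ← div_eq_mul_inv, div_mul_eq_mul_div, le_div_iff₀ hBr]
        linarith
    _ = _ := by ring

theorem abs_setAverage_sub_le {μ : Measure X} {A : Set X} {u : X → ℝ} (c : ℝ)
    (hu : IntegrableOn u A μ) (hA : μ A ≠ 0) (hA' : μ A ≠ ∞) :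
    |(⨍ y in A, u y ∂μ) - c| ≤ ⨍ y in A, |u y - c| ∂μ := by
  have : (⨍ y in A, u y ∂μ) - c = ⨍ y in A, (u y - c) ∂μ := by
    rw [setAverage_eq, setAverage_eq, integral_sub hu (integrableOn_const hA')]
    have : μ.real A ≠ 0 := (ENNReal.toReal_pos hA hA').ne'
    simp only [integral_const, smul_eq_mul, measureReal_restrict_apply_univ]
    field_simp
  rw [this, setAverage_eq, setAverage_eq, smul_eq_mul, smul_eq_mul, abs_mul,
    abs_of_nonneg (inv_nonneg.2 measureReal_nonneg)]
  gcongr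
  exact abs_integral_le_integral_abs

theorem abs_setAverage_sub_setAverage_le {μ : Measure X} {A B : Set X} {u : X → ℝ} {D : ℝ≥0}
    (hAB : A ⊆ B) (hu : IntegrableOn u B μ) (hD : μ B ≤ D * μ A)
    (hA : μ A ≠ 0) (hB : μ B ≠ ∞) :
    |(⨍ y in A, u y ∂μ) - ⨍ y in B, u y ∂μ| ≤
      D * ⨍ y in B, |u y - ⨍ z in B, u z ∂μ| ∂μ :=
  (abs_setAverage_sub_le _ (hu.mono_set hAB) hA
    (ne_top_of_le_ne_top hB (measure_mono hAB))).trans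
    (setAverage_le_mul_setAverage hAB (fun _ => abs_nonneg _)
      ((hu.sub (integrableOn_const hB)).abs) hD hA hB)

theorem enorm_setAverage_le {μ : Measure X} {A : Set X} (f : X → ℝ) :
    ‖⨍ y in A, f y ∂μ‖ₑ ≤ (μ A)⁻¹ * ∫⁻ y in A, ‖f y‖ₑ ∂μ := by
  rw [setAverage_eq, smul_eq_mul, enorm_mul]
  gcongr
  · rw [Real.enorm_eq_ofReal (inv_nonneg.2 measureReal_nonneg), Measure.real, ← ENNReal.toReal_inv]
    exact ENNReal.ofReal_toReal_le
  · exact enorm_integral_le_lintegral_enorm _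

/-- The measure `|g|^p dμ`. -/
noncomputable def gradMeasure (μ : Measure X) (p : ℝ) (g : X → ℝ) : Measure X :=
  μ.withDensity fun y => ‖g y‖ₑ ^ p

theorem gradMeasure_univ_le {μ : Measure X} {p : ℝ} (hp : 1 ≤ p) {g : X → ℝ} {τ : ℝ≥0∞}
    (h : eLpNorm g (ENNReal.ofReal p) μ ≤ τ) : gradMeasure μ p g univ ≤ τ ^ p := by
  have hp0 : 0 < p := by linarith
  rw [eLpNorm_eq_lintegral_rpow_enorm_toReal (by simpa using hp0) ENNReal.ofReal_ne_top,
    ENNReal.toReal_ofReal hp0.le] at h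
  rw [gradMeasure, withDensity_apply _ MeasurableSet.univ, setLIntegral_univ]
  rwa [one_div, ENNReal.rpow_inv_le_iff hp0] at h

variable [MetricSpace X]

/-! ### Measurability of ball measures and averages in the centre -/

section Measurability

variable [OpensMeasurableSpace X]

/-- Lower semicontinuity: by continuity from below a slightly smaller concentric ball already has
measure above the level, and it lies in the ball of radius r about every nearby centre. -/
theorem measurable_measure_ball (m : Measure X) (r : ℝ) :
    Measurable fun x => m (ball x r) := by
  refine LowerSemicontinuous.measurable fun x y hy => ?_
  have hU : ball x r = ⋃ n : ℕ, ball x (r - 1 / ((n : ℝ) + 1)) := by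
    ext z
    simp only [mem_iUnion, mem_ball]
    constructor
    · intro hz
      obtain ⟨n, hn⟩ := exists_nat_one_div_lt (sub_pos.2 hz)
      exact ⟨n, by linarith⟩
    · rintro ⟨n, hn⟩
      have : (0 : ℝ) < 1 / ((n : ℝ) + 1) := by positivity
      linarith
  have hmono : Monotone fun n : ℕ => ball x (r - 1 / ((n : ℝ) + 1)) := by
    intro a b hab
    apply ball_subset_ball
    have : (1 : ℝ) / ((b : ℝ) + 1) ≤ 1 / ((a : ℝ) + 1) := by gcongr
    linarith
  change y < m (ball x r) at hy
  rw [hU, hmono.measure_iUnion, lt_iSup_iff] at hy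
  obtain ⟨n, hn⟩ := hy
  have hpos : (0 : ℝ) < 1 / ((n : ℝ) + 1) := by positivity
  filter_upwards [ball_mem_nhds x hpos] with x' hx'
  refine hn.trans_le (measure_mono (ball_subset_ball' ?_))
  rw [dist_comm]
  linarith [mem_ball.1 hx']

/-- The positive and negative parts of u serve as densities, so the integral is a difference of
measures of balls. -/
theorem measurable_setAverage_ball {μ : Measure X} {u : X → ℝ} {r : ℝ}
    (hu : ∀ x, IntegrableOn u (ball x r) μ) :
    Measurable fun x => ⨍ y in ball x r, u y ∂μ := by
  have : (fun x => ⨍ y in ball x r, u y ∂μ) = fun x => (μ (ball x r)).toReal⁻¹ *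
      (((μ.withDensity fun y => ENNReal.ofReal (u y)) (ball x r)).toReal -
        ((μ.withDensity fun y => ENNReal.ofReal (-u y)) (ball x r)).toReal) := by
    ext x
    rw [setAverage_eq, integral_eq_lintegral_pos_part_sub_lintegral_neg_part (hu x),
      withDensity_apply _ measurableSet_ball, withDensity_apply _ measurableSet_ball]
    rfl
  rw [this]
  exact (measurable_measure_ball _ _).ennreal_toReal.inv.mul
    ((measurable_measure_ball _ _).ennreal_toReal.sub
      (measurable_measure_ball _ _).ennreal_toReal)

end Measurability

/-! ### Doubling -/

/-- `ν(B(x, Lr)) ≤ D ν(B(x, r))` with both positive and finite, for `x ∈ E`, `0 < r ≤ ρ`. -/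
def EnlargementBoundOn (ν : Measure X) (E : Set X) (L ρ : ℝ) (D : ℝ≥0) : Prop :=
  ∀ x ∈ E, ∀ r : ℝ, 0 < r → r ≤ ρ →
    ν (ball x r) ≠ 0 ∧ ν (ball x (L * r)) ≤ D * ν (ball x r) ∧ ν (ball x (L * r)) ≠ ∞

theorem EnlargementBoundOn.mono {ν : Measure X} {E : Set X} {L ρ ρ' : ℝ} {D : ℝ≥0}
    (h : EnlargementBoundOn ν E L ρ D) (hρ : ρ' ≤ ρ) : EnlargementBoundOn ν E L ρ' D :=
  fun x hx r hr hr' => h x hx r hr (hr'.trans hρ)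

/-- Doubling is iterated n times, where L < 2^n; shrinking the scale to r₀/2^n keeps all
intermediate radii admissible. -/
theorem LocallyDoublingOn.exists_enlargementBoundOn {ν : Measure X} {E : Set X} {r₀ : ℝ}
    (h : LocallyDoublingOn ν E r₀) (hr₀ : 0 < r₀) (L : ℝ) :
    ∃ ρ : ℝ, 0 < ρ ∧ ρ ≤ r₀ ∧ ∃ D : ℝ≥0, EnlargementBoundOn ν E L ρ D := by
  obtain ⟨C, hC, h⟩ := h
  have hfin : ∀ x ∈ E, ∀ r : ℝ, 0 < r → r ≤ r₀ → ν (ball x r) ≠ ∞ := by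
    intro x hx r hr hr' htop
    have := (h x hx r hr hr').2.2
    rw [htop, ENNReal.mul_top (by simpa using hC)] at this
    exact lt_irrefl _ this
  have hpos : ∀ x ∈ E, ∀ r : ℝ, 0 < r → r ≤ r₀ → ν (ball x r) ≠ 0 := by
    intro x hx r hr hr' h0
    have h1 := (h x hx r hr hr').1
    have h2 := (h x hx r hr hr').2.1
    rw [h0, mul_zero] at h2
    exact absurd h1 (not_lt.2 h2)
  have key : ∀ n : ℕ, ∀ x ∈ E, ∀ r : ℝ, 0 < r → 2 ^ n * r ≤ r₀ →
      ν (ball x (2 ^ n * r)) ≤ (C.toNNReal : ℝ≥0∞) ^ n * ν (ball x r) := by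
    intro n
    induction n with
    | zero => intro x _ r _ _; simp
    | succ n ih =>
      intro x hx r hr hr'
      have h1 : (2 : ℝ) ^ n * r ≤ r₀ := by
        refine le_trans ?_ hr'
        have : (0 : ℝ) < 2 ^ n := by positivity
        rw [pow_succ]; nlinarith
      calc ν (ball x (2 ^ (n + 1) * r)) = ν (ball x (2 * (2 ^ n * r))) := by
            rw [pow_succ]; ring_nf
        _ ≤ ENNReal.ofReal C * ν (ball x (2 ^ n * r)) :=
            (h x hx _ (by positivity) h1).2.1
        _ ≤ ENNReal.ofReal C * ((C.toNNReal : ℝ≥0∞) ^ n * ν (ball x r)) := by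
            gcongr; exact ih x hx r hr h1
        _ = _ := by rw [pow_succ, ENNReal.ofReal]; ring
  obtain ⟨n, hn⟩ := pow_unbounded_of_one_lt L (one_lt_two (α := ℝ))
  have h2n : (1 : ℝ) ≤ 2 ^ n := one_le_pow₀ one_le_two
  refine ⟨r₀ / 2 ^ n, by positivity, div_le_self hr₀.le h2n, C.toNNReal ^ n, ?_⟩
  intro x hx r hr hr'
  have h1 : 2 ^ n * r ≤ r₀ := by rwa [le_div_iff₀' (by positivity)] at hr'
  have h2 : ν (ball x (L * r)) ≤ ν (ball x (2 ^ n * r)) :=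
    measure_mono (ball_subset_ball (by gcongr))
  refine ⟨hpos x hx r hr (hr'.trans (div_le_self hr₀.le h2n)), ?_, ?_⟩
  · push_cast
    exact h2.trans (key n x hx r hr h1)
  · exact ne_top_of_le_ne_top (hfin x hx _ (by positivity) h1) h2

theorem EnlargementBoundOn.measure_ball_ne_top {ν : Measure X} {E : Set X} {L ρ : ℝ} {D : ℝ≥0}
    (h : EnlargementBoundOn ν E L ρ D) (hL : 1 ≤ L) {x : X} (hx : x ∈ E) {r : ℝ} (hr : 0 < r)
    (hr' : r ≤ ρ) : ν (ball x r) ≠ ∞ :=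
  ne_top_of_le_ne_top (h x hx r hr hr').2.2 (measure_mono (ball_subset_ball (by nlinarith)))

theorem TotallyBounded.measure_ne_top {ν : Measure X} {E : Set X} {L ρ : ℝ} {D : ℝ≥0}
    (hE : TotallyBounded E) (h : EnlargementBoundOn ν E L ρ D) (hL : 1 ≤ L) (hρ : 0 < ρ) :
    ν E ≠ ∞ := by
  obtain ⟨t, htE, htf, ht⟩ := hE.exists_subset (Metric.dist_mem_uniformity hρ)
  refine ne_top_of_le_ne_top ?_ (measure_mono ht)
  refine (measure_biUnion_lt_top htf fun y hy => ?_).ne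
  exact (h.measure_ball_ne_top hL (htE hy) hρ le_rfl).lt_top

/-! ### Fractional averages of the gradient -/

/-- `r^α (m(B(x, λr)) / μ(B(x, r)))^{1/p}`. -/
noncomputable def fracAvg (μ m : Measure X) (α p lam r : ℝ) (x : X) : ℝ≥0∞ :=
  ENNReal.ofReal (r ^ α) * ((μ (ball x r))⁻¹ * m (ball x (lam * r))) ^ (1 / p)

theorem measurable_fracAvg [OpensMeasurableSpace X] (μ m : Measure X) (α p lam r : ℝ) :
    Measurable (fracAvg μ m α p lam r) :=
  (((measurable_measure_ball μ r).inv.mul (measurable_measure_ball m _)).pow_const _).const_mul _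

/-- Normalising by μ(B) instead of the larger μ(λB) only increases the right-hand side. Stated in
extended values, the bound needs no integrability of g^p. -/
theorem PoincareIneqOn.ofReal_le [OpensMeasurableSpace X] {μ : Measure X} {E : Set X}
    {α p lam r₀ K : ℝ} {u g : X → ℝ} (h : PoincareIneqOn μ E α p lam r₀ K u g)
    (hp : 1 ≤ p) (hlam : 1 ≤ lam) {x : X} (hx : x ∈ E) {r : ℝ} (hr : 0 < r) (hr' : r ≤ r₀) :
    ENNReal.ofReal (⨍ y in ball x r, |u y - ⨍ z in ball x r, u z ∂μ| ∂μ) ≤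
      (‖K‖₊ : ℝ≥0∞) * fracAvg μ (gradMeasure μ p g) α p lam r x := by
  have hp0 : 0 < p := by linarith
  have hsub : ball x r ⊆ ball x (lam * r) := ball_subset_ball (by nlinarith)
  set A := ⨍ y in ball x (lam * r), g y ^ p ∂μ with hA
  have hAe : ‖A‖ₑ ≤ (μ (ball x r))⁻¹ * gradMeasure μ p g (ball x (lam * r)) := by
    refine (enorm_setAverage_le _).trans ?_
    rw [gradMeasure, withDensity_apply _ measurableSet_ball]
    gcongr with y
    rw [Real.enorm_eq_ofReal_abs, Real.enorm_eq_ofReal_abs,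
      ENNReal.ofReal_rpow_of_nonneg (abs_nonneg _) hp0.le]
    exact ENNReal.ofReal_le_ofReal (Real.abs_rpow_le_abs_rpow _ _)
  have hrα : 0 ≤ r ^ α := Real.rpow_nonneg hr.le _
  calc _ ≤ ENNReal.ofReal (|K| * r ^ α * |A| ^ (1 / p)) := by
        refine ENNReal.ofReal_le_ofReal ((h x hx r hr hr').trans ((le_abs_self _).trans ?_))
        rw [abs_mul, abs_mul, abs_of_nonneg hrα]
        exact mul_le_mul_of_nonneg_left (Real.abs_rpow_le_abs_rpow _ _) (by positivity)
    _ = (‖K‖₊ : ℝ≥0∞) * (ENNReal.ofReal (r ^ α) * ‖A‖ₑ ^ (1 / p)) := by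
        rw [ENNReal.ofReal_mul (by positivity), ENNReal.ofReal_mul (abs_nonneg _), mul_assoc,
          Real.enorm_eq_ofReal_abs, ENNReal.ofReal_rpow_of_nonneg (abs_nonneg _) (by positivity),
          ← Real.enorm_eq_ofReal_abs K, enorm_eq_nnnorm]
    _ ≤ _ := by
        unfold fracAvg
        gcongr

end Averages

section Covering

variable {X : Type*} [MeasurableSpace X]

/-! ### Dyadic layer cake -/

/-- If τ < a < ∞, the single term with τ2^k < a ≤ τ2^{k+1} dominates. If a = ∞, every term is at
least τ^q and the sum diverges. -/
theorem ENNReal.rpow_le_rpow_add_tsum {τ : ℝ≥0∞} (hτ : τ ≠ 0) (hτ' : τ ≠ ∞) {q : ℝ} (hq : 0 < q)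
    (a : ℝ≥0∞) :
    a ^ q ≤ τ ^ q + ∑' k : ℕ, if τ * 2 ^ k < a then (τ * 2 ^ (k + 1)) ^ q else 0 := by
  by_cases ha : a = ∞
  · subst ha
    refine le_top.trans (le_trans (b := ∑' _ : ℕ, τ ^ q) ?_ (le_trans ?_ le_add_self))
    · exact (ENNReal.tsum_const_eq_top_of_ne_zero (by simp [hτ, hτ'])).ge
    refine ENNReal.tsum_le_tsum fun k => ?_
    rw [if_pos (ENNReal.mul_lt_top hτ'.lt_top (ENNReal.pow_lt_top ENNReal.ofNat_lt_top))]
    gcongr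
    exact le_mul_of_one_le_right' (one_le_pow₀ one_le_two)
  · have hex : ∃ k : ℕ, a ≤ τ * 2 ^ k := by
      obtain ⟨n, hn⟩ := ENNReal.exists_nat_gt (ENNReal.div_ne_top ha hτ)
      refine ⟨n, ?_⟩
      rw [mul_comm, ← ENNReal.div_le_iff hτ hτ']
      refine hn.le.trans ?_
      exact_mod_cast Nat.lt_two_pow_self.le
    classical
    rcases h0 : Nat.find hex with _ | k
    · have := Nat.find_spec hex
      rw [h0, pow_zero, mul_one] at this
      exact (ENNReal.rpow_le_rpow this hq.le).trans le_self_add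
    · have h1 := Nat.find_spec hex
      have h2 := Nat.find_min hex (m := k) (by omega)
      rw [h0] at h1
      refine le_trans ?_ (le_add_left (ENNReal.le_tsum k))
      rw [if_pos (not_le.1 h2)]
      gcongr

theorem MeasureTheory.lintegral_rpow_le_tsum {ν : Measure X} {f : X → ℝ≥0∞}
    (hf : AEMeasurable f ν) {q : ℝ} (hq : 0 < q) {τ : ℝ≥0∞} (hτ : τ ≠ 0) (hτ' : τ ≠ ∞) :
    ∫⁻ x, f x ^ q ∂ν ≤
      τ ^ q * ν univ + ∑' k : ℕ, (τ * 2 ^ (k + 1)) ^ q * ν {x | τ * 2 ^ k < f x} := by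
  have hm : ∀ k : ℕ, NullMeasurableSet {x | τ * 2 ^ k < f x} ν := fun k =>
    nullMeasurableSet_lt aemeasurable_const hf
  have he : ∀ k : ℕ, (fun x => if τ * 2 ^ k < f x then (τ * 2 ^ (k + 1)) ^ q else 0) =
      {x | τ * 2 ^ k < f x}.indicator fun _ => (τ * 2 ^ (k + 1)) ^ q := by
    intro k; ext x; simp [Set.indicator]
  calc ∫⁻ x, f x ^ q ∂ν ≤ ∫⁻ x, (τ ^ q +
        ∑' k : ℕ, if τ * 2 ^ k < f x then (τ * 2 ^ (k + 1)) ^ q else 0) ∂ν :=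
      lintegral_mono fun x => ENNReal.rpow_le_rpow_add_tsum hτ hτ' hq _
    _ = _ := by
      rw [lintegral_add_left measurable_const, lintegral_const, lintegral_tsum]
      · congr 2
        ext k
        rw [he k, lintegral_indicator_const₀ (hm k)]
      · intro k
        rw [he k]
        exact aemeasurable_const.indicator₀ (hm k)

/-- In the dyadic layer cake based at τ, the level τ2^k contributes a multiple of τ^q 2^{k(q−q₁)}, a
convergent geometric series; the values below τ cost τ^q ν(univ), finite by assumption. -/
theorem MeasureTheory.exists_lintegral_rpow_le_of_weak (ν : Measure X) [IsFiniteMeasure ν]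
    {q q₁ : ℝ} (hq : 0 < q) (hqq : q < q₁) (B : ℝ≥0) :
    ∃ C : ℝ≥0, ∀ f : X → ℝ≥0∞, AEMeasurable f ν → ∀ τ : ℝ≥0∞, τ ≠ 0 → τ ≠ ∞ →
      (∀ t : ℝ≥0∞, t ≠ 0 → t ≠ ∞ → ν {x | t < f x} ≤ B * (τ / t) ^ q₁) →
      ∫⁻ x, f x ^ q ∂ν ≤ C * τ ^ q := by
  have hlt : (2 : ℝ≥0∞) ^ (q - q₁) < 1 := ENNReal.rpow_lt_one_of_one_lt_of_neg (by simp)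
    (by linarith)
  have hS : ∑' k : ℕ, ((2 : ℝ≥0∞) ^ (q - q₁)) ^ k ≠ ∞ := by
    rw [ENNReal.tsum_geometric]
    exact ENNReal.inv_ne_top.2 (tsub_pos_of_lt hlt).ne'
  have hC : ν univ + B * 2 ^ q * ∑' k : ℕ, ((2 : ℝ≥0∞) ^ (q - q₁)) ^ k ≠ ∞ := by
    refine ENNReal.add_ne_top.2 ⟨measure_ne_top _ _, ENNReal.mul_ne_top (ENNReal.mul_ne_top
      ENNReal.coe_ne_top (ENNReal.rpow_ne_top_of_nonneg hq.le (by simp))) hS⟩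
  refine ⟨(ν univ + B * 2 ^ q * ∑' k : ℕ, ((2 : ℝ≥0∞) ^ (q - q₁)) ^ k).toNNReal, ?_⟩
  intro f hf τ hτ hτ' hw
  rw [ENNReal.coe_toNNReal hC]
  refine (lintegral_rpow_le_tsum hf hq hτ hτ').trans ?_
  rw [add_mul, mul_comm (ν univ)]
  gcongr
  rw [← ENNReal.tsum_mul_left, ← ENNReal.tsum_mul_right]
  refine ENNReal.tsum_le_tsum fun k => ?_
  have h2k : (2 : ℝ≥0∞) ^ k ≠ 0 := by simp
  have h2k' : (2 : ℝ≥0∞) ^ k ≠ ∞ := by simp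
  refine (mul_le_mul_right (hw _ (mul_ne_zero hτ h2k) (ENNReal.mul_ne_top hτ' h2k')) _).trans ?_
  have e1 : τ / (τ * 2 ^ k) = (2 ^ k)⁻¹ := by
    rw [ENNReal.div_eq_inv_mul, ENNReal.mul_inv (Or.inl hτ) (Or.inl hτ'), mul_comm, ← mul_assoc,
      ENNReal.mul_inv_cancel hτ hτ', one_mul]
  have e2 : ((2 : ℝ≥0∞) ^ (q - q₁)) ^ k = (2 ^ k) ^ q * ((2 ^ k)⁻¹) ^ q₁ := by
    rw [← ENNReal.rpow_natCast, ← ENNReal.rpow_mul, ← ENNReal.rpow_natCast 2 k,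
      ← ENNReal.rpow_mul, ← ENNReal.rpow_neg, ← ENNReal.rpow_mul,
      ← ENNReal.rpow_add _ _ (by simp) (by simp)]
    congr 1; ring
  rw [e1, e2, ENNReal.mul_rpow_of_nonneg _ _ hq.le, pow_succ,
    ENNReal.mul_rpow_of_nonneg _ _ hq.le]
  apply le_of_eq; ring

/-! ### Covering -/

variable [MetricSpace X] [OpensMeasurableSpace X]

/-- A disjoint Vitali subfamily of the balls of radius λr covers S after enlargement. Since κ ≥ 1,
m(B)^κ ≤ m(X)^{κ−1} m(B), and the masses of disjoint balls sum to at most m(X). -/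
theorem EnlargementBoundOn.measure_le_of_ball_le {ν m : Measure X} [IsFiniteMeasure m]
    {E S : Set X} {lam ρ : ℝ} {D : ℝ≥0} (hν : EnlargementBoundOn ν E (6 * lam) ρ D)
    (hlam : 1 ≤ lam) (hS : S ⊆ E) {κ : ℝ} (hκ : 1 ≤ κ) {W : ℝ≥0∞}
    (h : ∀ x ∈ S, ∃ r : ℝ, 0 < r ∧ r ≤ ρ ∧ ν (ball x r) ≤ W * m (ball x (lam * r)) ^ κ) :
    ν S ≤ D * (W * m univ ^ κ) := by
  choose! r hr0 hrρ hr using h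
  obtain ⟨u, huS, hdisj, hcov⟩ :=
    Vitali.exists_disjoint_subfamily_covering_enlargement_closedBall S id (fun x => lam * r x)
      (lam * ρ) (fun a ha => by have := hrρ a ha; gcongr) 5 (by norm_num)
  -- Positive `m`-mass of the selected balls, together with finiteness of `m`, makes the disjoint
  -- family countable.
  have hm0 : ∀ x ∈ S, m (ball x (lam * r x)) ≠ 0 := by
    intro x hx h0
    have h1 := hr x hx
    rw [h0, ENNReal.zero_rpow_of_pos (by linarith), mul_zero] at h1
    exact (hν x (hS hx) _ (hr0 x hx) (hrρ x hx)).1 (le_antisymm h1 bot_le)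
  have hpair : Pairwise (Function.onFun Disjoint fun x : u => ball (x : X) (lam * r x)) := by
    intro a b hab
    exact (hdisj a.2 b.2 (fun h => hab (Subtype.ext h))).mono ball_subset_closedBall
      ball_subset_closedBall
  have hcount : u.Countable := by
    have := Measure.countable_meas_pos_of_disjoint_iUnion (μ := m)
      (fun x : u => measurableSet_ball (x := (x : X)) (ε := lam * r x)) hpair
    have huniv : {i : u | 0 < m (ball (i : X) (lam * r i))} = univ :=
      eq_univ_of_forall fun i => pos_iff_ne_zero.2 (hm0 _ (huS i.2))
    rw [huniv, countable_univ_iff] at this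
    exact countable_coe_iff.1 this
  have : Countable u := hcount
  -- Vitali covers by closed balls of radius 5λr; the factor 6λ leaves room to return to open balls.
  have hsub : S ⊆ ⋃ x : u, ball (x : X) (6 * lam * r x) := by
    intro a ha
    obtain ⟨b, hb, hab⟩ := hcov a ha
    have h1 : a ∈ closedBall (id b) (5 * (lam * r b)) :=
      hab (mem_closedBall_self (by have := hr0 a ha; positivity))
    refine mem_iUnion.2 ⟨⟨b, hb⟩, ?_⟩
    have := hr0 b (huS hb)
    have h2 : 0 < lam * r b := by positivity
    have h3 := mem_closedBall.1 h1
    simp only [id] at h3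
    exact mem_ball.2 (by simp only; linarith)
  calc ν S ≤ ∑' x : u, ν (ball (x : X) (6 * lam * r x)) :=
        (measure_mono hsub).trans (measure_iUnion_le _)
    _ ≤ ∑' x : u, (D * (W * m univ ^ (κ - 1))) * m (ball (x : X) (lam * r x)) := by
        refine ENNReal.tsum_le_tsum fun x => ?_
        have hxS := huS x.2
        refine (hν x (hS hxS) _ (hr0 x hxS) (hrρ x hxS)).2.1.trans ?_
        rw [mul_assoc]
        gcongr
        refine (hr x hxS).trans ?_
        rw [mul_assoc]
        gcongr
        calc m (ball (x : X) (lam * r x)) ^ κ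
            = m (ball (x : X) (lam * r x)) ^ (κ - 1) * m (ball (x : X) (lam * r x)) := by
              conv_lhs => rw [show κ = (κ - 1) + 1 by ring]
              rw [ENNReal.rpow_add_of_nonneg _ _ (by linarith) zero_le_one, ENNReal.rpow_one]
          _ ≤ _ := by gcongr; exact subset_univ _
    _ = (D * (W * m univ ^ (κ - 1))) * m (⋃ x : u, ball (x : X) (lam * r x)) := by
        rw [ENNReal.tsum_mul_left, measure_iUnion hpair fun x => measurableSet_ball]
    _ ≤ (D * (W * m univ ^ (κ - 1))) * m univ := by gcongr; exact subset_univ _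
    _ = D * (W * m univ ^ κ) := by
        conv_rhs => rw [show κ = (κ - 1) + 1 by ring]
        rw [ENNReal.rpow_add_of_nonneg _ _ (by linarith) zero_le_one, ENNReal.rpow_one]
        ring

/-! ### Weak and strong type bounds for the dyadic fractional maximal function -/

/-- `ν(B) ≤ A r^β μ(B)^{q/p}` for balls centred in `E` of radius `r ≤ ρ`. -/
def MassBalanceOn (μ ν : Measure X) (E : Set X) (p q β ρ : ℝ) (A : ℝ≥0) : Prop :=
  ∀ x ∈ E, ∀ r : ℝ, 0 < r → r ≤ ρ →
    ν (ball x r) ≤ A * ENNReal.ofReal (r ^ β) * μ (ball x r) ^ (q / p)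

omit [OpensMeasurableSpace X] in
-- The power μ(B)^{q/p} from the balance cancels the normalisation in the fractional average,
-- leaving only a power of r and the mass m(λB).
theorem MassBalanceOn.mul_fracAvg_rpow_le {μ ν : Measure X} {E : Set X} {p q β ρ : ℝ} {A : ℝ≥0}
    (h : MassBalanceOn μ ν E p q β ρ A) (hp : 0 < p) (hq : 0 < q) (m : Measure X) (α lam : ℝ)
    {x : X} (hx : x ∈ E) {r : ℝ} (hr : 0 < r) (hr' : r ≤ ρ) :
    ν (ball x r) * fracAvg μ m α p lam r x ^ q ≤
      A * ENNReal.ofReal (r ^ (α * q + β)) * m (ball x (lam * r)) ^ (q / p) := by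
  have hqp : 0 ≤ q / p := by positivity
  have e : fracAvg μ m α p lam r x ^ q = ENNReal.ofReal (r ^ (α * q)) *
      (((μ (ball x r))⁻¹) ^ (q / p) * m (ball x (lam * r)) ^ (q / p)) := by
    rw [fracAvg, ENNReal.mul_rpow_of_nonneg _ _ hq.le, ← ENNReal.rpow_mul,
      ENNReal.ofReal_rpow_of_nonneg (Real.rpow_nonneg hr.le _) hq.le, ← Real.rpow_mul hr.le,
      ← ENNReal.mul_rpow_of_nonneg _ _ hqp]
    congr 2
    ring
  calc ν (ball x r) * fracAvg μ m α p lam r x ^ q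
      ≤ (A * ENNReal.ofReal (r ^ β) * μ (ball x r) ^ (q / p)) * (ENNReal.ofReal (r ^ (α * q)) *
      (((μ (ball x r))⁻¹) ^ (q / p) * m (ball x (lam * r)) ^ (q / p))) := by
        rw [e]; gcongr; exact h x hx r hr hr'
    _ = A * (ENNReal.ofReal (r ^ (α * q)) * ENNReal.ofReal (r ^ β)) *
        (μ (ball x r) * (μ (ball x r))⁻¹) ^ (q / p) * m (ball x (lam * r)) ^ (q / p) := by
        rw [ENNReal.mul_rpow_of_nonneg _ _ hqp]; ring
    _ ≤ A * (ENNReal.ofReal (r ^ (α * q)) * ENNReal.ofReal (r ^ β)) *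
        1 * m (ball x (lam * r)) ^ (q / p) := by
        gcongr
        exact ENNReal.rpow_le_one (ENNReal.mul_inv_le_one _) hqp
    _ = _ := by
        rw [mul_one, ← ENNReal.ofReal_mul (Real.rpow_nonneg hr.le _), ← Real.rpow_add hr]

/-- The supremum over `j` of `2^{jε}` times the fractional average at radius `ρ / 2^j`. -/
noncomputable def dyadicMax (μ m : Measure X) (α p lam ρ ε : ℝ) (x : X) : ℝ≥0∞ :=
  ⨆ j : ℕ, ENNReal.ofReal ((2 ^ j : ℝ) ^ ε) * fracAvg μ m α p lam (ρ / 2 ^ j) x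

theorem measurable_dyadicMax (μ m : Measure X) (α p lam ρ ε : ℝ) :
    Measurable (dyadicMax μ m α p lam ρ ε) :=
  Measurable.iSup fun _ => (measurable_fracAvg _ _ _ _ _ _).const_mul _

/-- Where the supremum exceeds t, one radius r = ρ/2^j witnesses it. The weight 2^{jεq} exactly
compensates r^{αq+β} = r^{εq}, so the resulting bound on ν(B) is independent of j and the covering
lemma applies with κ = q/p. -/
theorem MassBalanceOn.measure_lt_dyadicMax_le {μ ν m : Measure X} [IsFiniteMeasure m]
    {E : Set X} {α p q β ρ lam ε : ℝ} {A D : ℝ≥0}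
    (h : MassBalanceOn μ ν E p q β ρ A) (hν : EnlargementBoundOn ν E (6 * lam) ρ D)
    (hlam : 1 ≤ lam) (hρ : 0 < ρ) (hp : 0 < p) (hq : p ≤ q) (hε : ε * q = α * q + β)
    {t : ℝ≥0∞} (ht : t ≠ 0) (ht' : t ≠ ∞) :
    ν ({x | t < dyadicMax μ m α p lam ρ ε x} ∩ E) ≤
      D * (A * ENNReal.ofReal (ρ ^ (ε * q)) * (t ^ q)⁻¹ * m univ ^ (q / p)) := by
  have hq0 : 0 < q := hp.trans_le hq
  refine hν.measure_le_of_ball_le hlam inter_subset_right ((one_le_div hp).2 hq) ?_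
  rintro x ⟨hxt, hxE⟩
  obtain ⟨j, hj⟩ := lt_iSup_iff.1 (show t < ⨆ j : ℕ, _ from hxt)
  have h2 : (0 : ℝ) < 2 ^ j := by positivity
  have hr : 0 < ρ / 2 ^ j := by positivity
  have hr' : ρ / 2 ^ j ≤ ρ := div_le_self hρ.le (one_le_pow₀ one_le_two)
  refine ⟨ρ / 2 ^ j, hr, hr', ?_⟩
  have hk := h.mul_fracAvg_rpow_le hp hq0 m α lam hxE hr hr'
  have htq : t ^ q ≠ 0 := by simp [ht, ht']
  have htq' : t ^ q ≠ ∞ := ENNReal.rpow_ne_top_of_nonneg hq0.le ht'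
  have hpow : (2 ^ j : ℝ) ^ (ε * q) * (ρ / 2 ^ j) ^ (ε * q) = ρ ^ (ε * q) := by
    rw [← Real.mul_rpow h2.le hr.le, mul_div_cancel₀ _ h2.ne']
  calc ν (ball x (ρ / 2 ^ j)) = (t ^ q)⁻¹ * (t ^ q * ν (ball x (ρ / 2 ^ j))) := by
        rw [← mul_assoc, ENNReal.inv_mul_cancel htq htq', one_mul]
    _ ≤ (t ^ q)⁻¹ * ((ENNReal.ofReal ((2 ^ j : ℝ) ^ ε) *
          fracAvg μ m α p lam (ρ / 2 ^ j) x) ^ q * ν (ball x (ρ / 2 ^ j))) := by gcongr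
    _ = (t ^ q)⁻¹ * (ENNReal.ofReal ((2 ^ j : ℝ) ^ (ε * q)) *
          (ν (ball x (ρ / 2 ^ j)) * fracAvg μ m α p lam (ρ / 2 ^ j) x ^ q)) := by
        rw [ENNReal.mul_rpow_of_nonneg _ _ hq0.le,
          ENNReal.ofReal_rpow_of_nonneg (Real.rpow_nonneg h2.le _) hq0.le, ← Real.rpow_mul h2.le]
        ring
    _ ≤ (t ^ q)⁻¹ * (ENNReal.ofReal ((2 ^ j : ℝ) ^ (ε * q)) *
          (A * ENNReal.ofReal ((ρ / 2 ^ j) ^ (ε * q)) *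
            m (ball x (lam * (ρ / 2 ^ j))) ^ (q / p))) := by
        rw [hε] at *; gcongr
    _ = A * (ENNReal.ofReal ((2 ^ j : ℝ) ^ (ε * q)) * ENNReal.ofReal ((ρ / 2 ^ j) ^ (ε * q)))
          * (t ^ q)⁻¹ * m (ball x (lam * (ρ / 2 ^ j))) ^ (q / p) := by ring
    _ = _ := by
        rw [← ENNReal.ofReal_mul (Real.rpow_nonneg h2.le _), hpow]

/-- Strong type bound below the weak exponent. -/
theorem MassBalanceOn.exists_lintegral_dyadicMax_le {μ ν : Measure X}
    {E : Set X} {α p q q₁ β ρ lam ε : ℝ} {A D : ℝ≥0}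
    (h : MassBalanceOn μ ν E p q₁ β ρ A) (hν : EnlargementBoundOn ν E (6 * lam) ρ D)
    (hE : NullMeasurableSet E ν) (hE' : ν E ≠ ∞)
    (hlam : 1 ≤ lam) (hρ : 0 < ρ) (hp : 0 < p) (hq₁ : p ≤ q₁) (hε : ε * q₁ = α * q₁ + β)
    (hq : 0 < q) (hqq : q < q₁) :
    ∃ C : ℝ≥0, ∀ m : Measure X, ∀ τ : ℝ≥0∞, τ ≠ 0 → τ ≠ ∞ → m univ ≤ τ ^ p →
      ∫⁻ x in E, dyadicMax μ m α p lam ρ ε x ^ q ∂ν ≤ C * τ ^ q := by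
  have : IsFiniteMeasure (ν.restrict E) := ⟨by simpa using hE'.lt_top⟩
  obtain ⟨C, hC⟩ := exists_lintegral_rpow_le_of_weak (ν.restrict E) hq hqq
    (D * (A * (ρ ^ (ε * q₁)).toNNReal))
  refine ⟨C, fun m τ hτ hτ' hm => hC _ (measurable_dyadicMax ..).aemeasurable τ hτ hτ' ?_⟩
  intro t ht ht'
  have hq1 : 0 < q₁ := hp.trans_le hq₁
  have : IsFiniteMeasure m := ⟨hm.trans_lt (ENNReal.rpow_lt_top_of_nonneg hp.le hτ')⟩
  rw [Measure.restrict_apply₀' hE]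
  refine (h.measure_lt_dyadicMax_le hν hlam hρ hp hq₁ hε ht ht').trans ?_
  have hmq : m univ ^ (q₁ / p) ≤ τ ^ q₁ := by
    calc m univ ^ (q₁ / p) ≤ (τ ^ p) ^ (q₁ / p) := by gcongr
      _ = τ ^ q₁ := by rw [← ENNReal.rpow_mul, mul_div_cancel₀ _ hp.ne']
  rw [ENNReal.div_rpow_of_nonneg _ _ hq1.le, ENNReal.div_eq_inv_mul]
  push_cast
  rw [← mul_assoc, ← mul_assoc, ENNReal.ofReal, mul_assoc _ (t ^ q₁)⁻¹, ← mul_assoc (D : ℝ≥0∞)]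
  gcongr

end Covering

section Telescoping

variable {X : Type*} [MeasurableSpace X] [MetricSpace X]

/-! ### Lebesgue values -/

/-- `⨍_{B(x, r)} |u - L| dμ → 0` as `r → 0`. -/
def IsLebesgueValue (μ : Measure X) (u : X → ℝ) (x : X) (L : ℝ) : Prop :=
  Tendsto (fun r => ⨍ y in ball x r, |u y - L| ∂μ) (𝓝[>] 0) (𝓝 0)

theorem IsLebesgueValue.tendsto_setAverage {μ : Measure X} {u : X → ℝ} {x : X} {L ρ : ℝ}
    (h : IsLebesgueValue μ u x L) (hu : ∀ r ≤ ρ, IntegrableOn u (ball x r) μ) (hρ : 0 < ρ)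
    (hx : ∀ r, 0 < r → r ≤ ρ → μ (ball x r) ≠ 0 ∧ μ (ball x r) ≠ ∞) :
    Tendsto (fun r => ⨍ y in ball x r, u y ∂μ) (𝓝[>] 0) (𝓝 L) := by
  rw [tendsto_iff_dist_tendsto_zero]
  refine squeeze_zero' (Eventually.of_forall fun _ => dist_nonneg) ?_ h
  filter_upwards [Ioc_mem_nhdsGT hρ] with r hr
  exact abs_setAverage_sub_le L (hu r hr.2) (hx r hr.1 hr.2).1 (hx r hr.1 hr.2).2

theorem preciseRepE_eq_of_tendsto {μ : Measure X} {u : X → ℝ} {x : X} {L : ℝ}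
    (h : Tendsto (fun r => ⨍ y in ball x r, u y ∂μ) (𝓝[>] 0) (𝓝 L)) :
    preciseRepE μ u x = (L : EReal) :=
  ((continuous_coe_real_ereal.tendsto L).comp h).limsup_eq

theorem preciseRep_eq_of_tendsto {μ : Measure X} {u : X → ℝ} {x : X} {L : ℝ}
    (h : Tendsto (fun r => ⨍ y in ball x r, u y ∂μ) (𝓝[>] 0) (𝓝 L)) :
    preciseRep μ u x = L := by
  rw [preciseRep, preciseRepE_eq_of_tendsto h, EReal.toReal_coe]

omit [MetricSpace X] in
theorem integrableOn_abs_sub_const {μ : Measure X} {u : X → ℝ} {A : Set X} (c : ℝ)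
    (hu : IntegrableOn u A μ) (hA : μ A ≠ ∞) : IntegrableOn (fun y => |u y - c|) A μ :=
  (hu.sub (integrableOn_const hA)).abs

/-- This is why Lebesgue values are defined by averages of |u − L|: unlike convergence of the
averages of u, that property passes to truncations. -/
theorem IsLebesgueValue.comp_lipschitz {μ : Measure X} {u : X → ℝ} {x : X} {L ρ : ℝ}
    (h : IsLebesgueValue μ u x L) (hu : ∀ r ≤ ρ, IntegrableOn u (ball x r) μ) (hρ : 0 < ρ)
    (hx : ∀ r, 0 < r → r ≤ ρ → μ (ball x r) ≠ 0 ∧ μ (ball x r) ≠ ∞) {T : ℝ → ℝ}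
    (hT : ∀ a b, |T a - T b| ≤ |a - b|) :
    IsLebesgueValue μ (fun y => T (u y)) x (T L) := by
  refine squeeze_zero' (Eventually.of_forall fun r => ?_) ?_ h
  · rw [setAverage_eq, smul_eq_mul]
    exact mul_nonneg (inv_nonneg.2 measureReal_nonneg) (integral_nonneg fun _ => abs_nonneg _)
  · filter_upwards [Ioc_mem_nhdsGT hρ] with r hr
    rw [setAverage_eq, setAverage_eq, smul_eq_mul, smul_eq_mul]
    refine mul_le_mul_of_nonneg_left ?_ (inv_nonneg.2 measureReal_nonneg)
    refine integral_mono_of_nonneg (Eventually.of_forall fun _ => abs_nonneg _)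
      (integrableOn_abs_sub_const L (hu r hr.2) (hx r hr.1 hr.2).2)
      (Eventually.of_forall fun y => hT _ _)

omit [MetricSpace X] in
theorem setAverage_abs_nonneg {μ : Measure X} {A : Set X} {u : X → ℝ} {c : ℝ} :
    0 ≤ ⨍ y in A, |u y - c| ∂μ := by
  rw [setAverage_eq, smul_eq_mul]
  exact mul_nonneg (inv_nonneg.2 measureReal_nonneg) (integral_nonneg fun _ => abs_nonneg _)

omit [MetricSpace X] in
theorem setAverage_abs_sub_le_add {μ : Measure X} {A : Set X} {u : X → ℝ} (b c : ℝ)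
    (hu : IntegrableOn u A μ) (hA : μ A ≠ 0) (hA' : μ A ≠ ∞) :
    ⨍ y in A, |u y - c| ∂μ ≤ (⨍ y in A, |u y - b| ∂μ) + |b - c| := by
  have hr : μ.real A ≠ 0 := (ENNReal.toReal_pos hA hA').ne'
  have h1 : ∫ y in A, |u y - c| ∂μ ≤ ∫ y in A, (|u y - b| + |b - c|) ∂μ :=
    integral_mono (integrableOn_abs_sub_const c hu hA')
      ((integrableOn_abs_sub_const b hu hA').add (integrableOn_const hA'))
      fun y => abs_sub_le _ _ _
  rw [integral_add (integrableOn_abs_sub_const b hu hA') (integrableOn_const hA')] at h1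
  simp only [integral_const, smul_eq_mul, measureReal_restrict_apply_univ] at h1
  rw [setAverage_eq, setAverage_eq, smul_eq_mul, smul_eq_mul]
  calc _ ≤ (μ.real A)⁻¹ * ((∫ y in A, |u y - b| ∂μ) + μ.real A * |b - c|) := by
        gcongr
    _ = _ := by field_simp

/-! ### Telescoping -/

section Telescope

variable {μ : Measure X} {E : Set X} {ρ : ℝ} {D : ℝ≥0} {u : X → ℝ}

theorem EnlargementBoundOn.measure_ball (hμ : EnlargementBoundOn μ E 4 ρ D) {x : X} (hx : x ∈ E)
    (r : ℝ) (hr : 0 < r) (hr' : r ≤ ρ) : μ (ball x r) ≠ 0 ∧ μ (ball x r) ≠ ∞ :=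
  ⟨(hμ x hx r hr hr').1, hμ.measure_ball_ne_top (by norm_num) hx hr hr'⟩

theorem EnlargementBoundOn.ball_subset_ball_le (hμ : EnlargementBoundOn μ E 4 ρ D) {x : X}
    (hx : x ∈ E) {r r' : ℝ} (hr : 0 < r') (hrr : r' ≤ r) (hr2 : r ≤ 2 * r') (hr' : r ≤ ρ) :
    μ (ball x r) ≤ D * μ (ball x r') :=
  (measure_mono (ball_subset_ball (by linarith))).trans (hμ x hx r' hr (hrr.trans hr')).2.1

/-- Averages over consecutive dyadic balls differ by at most D times the oscillation on the larger
one. Summability makes them Cauchy; the limit is L and the tail of the series bounds the error. -/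
theorem exists_isLebesgueValue (hμ : EnlargementBoundOn μ E 4 ρ D) (hρ : 0 < ρ) {x : X}
    (hx : x ∈ E) (hu : ∀ r ≤ ρ, IntegrableOn u (ball x r) μ) {Φ : ℝ → ℝ≥0∞} {K : ℝ≥0}
    (hP : ∀ r, 0 < r → r ≤ ρ →
      ENNReal.ofReal (⨍ y in ball x r, |u y - ⨍ z in ball x r, u z ∂μ| ∂μ) ≤ K * Φ r)
    (hS : ∑' j : ℕ, Φ (ρ / 2 ^ j) ≠ ∞) :
    ∃ L : ℝ, IsLebesgueValue μ u x L ∧ ∀ n : ℕ,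
      ENNReal.ofReal |L - ⨍ y in ball x (ρ / 2 ^ n), u y ∂μ| ≤
        D * K * ∑' j : ℕ, Φ (ρ / 2 ^ (n + j)) := by
  have hr : ∀ j : ℕ, 0 < ρ / 2 ^ j := fun j => by positivity
  have hr' : ∀ j : ℕ, ρ / 2 ^ j ≤ ρ := fun j => div_le_self hρ.le (one_le_pow₀ one_le_two)
  set a : ℕ → ℝ := fun j => ⨍ y in ball x (ρ / 2 ^ j), u y ∂μ with ha
  set o : ℕ → ℝ := fun j => ⨍ y in ball x (ρ / 2 ^ j), |u y - a j| ∂μ with ho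
  have hPj : ∀ j, ENNReal.ofReal (o j) ≤ K * Φ (ρ / 2 ^ j) := fun j => hP _ (hr j) (hr' j)
  have ho0 : ∀ j, 0 ≤ o j := fun j => setAverage_abs_nonneg
  have hS' : ∑' j : ℕ, (D * K * Φ (ρ / 2 ^ j)) ≠ ∞ := by
    rw [ENNReal.tsum_mul_left]
    exact ENNReal.mul_ne_top (ENNReal.mul_ne_top ENNReal.coe_ne_top ENNReal.coe_ne_top) hS
  set d : ℕ → ℝ := fun j => (D * K * Φ (ρ / 2 ^ j)).toReal with hd
  have hdsum : Summable d := ENNReal.summable_toReal hS'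
  have hDo : ∀ j, D * o j ≤ d j := by
    intro j
    rw [hd, ← ENNReal.ofReal_le_iff_le_toReal (ENNReal.ne_top_of_tsum_ne_top hS' j),
      ENNReal.ofReal_mul D.coe_nonneg, mul_assoc]
    simp only [ENNReal.ofReal_coe_nnreal]
    gcongr
    exact hPj j
  have hcomp : ∀ j r, 0 < r → r ≤ ρ / 2 ^ j → ρ / 2 ^ j ≤ 2 * r →
      μ (ball x (ρ / 2 ^ j)) ≤ D * μ (ball x r) :=
    fun j r h1 h2 h3 => hμ.ball_subset_ball_le hx h1 h2 h3 (hr' j)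
  have hhalf : ∀ j : ℕ, ρ / 2 ^ j = 2 * (ρ / 2 ^ (j + 1)) := fun j => by rw [pow_succ]; field_simp
  have hstep : ∀ j, dist (a j) (a j.succ) ≤ d j := by
    intro j
    refine le_trans ?_ (hDo j)
    rw [dist_comm]
    exact abs_setAverage_sub_setAverage_le (ball_subset_ball (by
      have := hr (j + 1); rw [hhalf j, Nat.succ_eq_add_one]; linarith)) (hu _ (hr' _))
      (hcomp j _ (hr _) (by have := hr (j + 1); rw [hhalf j, Nat.succ_eq_add_one]; linarith)
        (hhalf j).le) (hμ.measure_ball hx _ (hr _) (hr' _)).1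
      (hμ.measure_ball hx _ (hr _) (hr' _)).2
  obtain ⟨L, hL⟩ := cauchySeq_tendsto_of_complete (cauchySeq_of_dist_le_of_summable d hstep hdsum)
  refine ⟨L, ?_, fun n => ?_⟩
  · have hbound : Tendsto (fun j => d j + D * |a j - L|) atTop (𝓝 0) := by
      have h1 := hdsum.tendsto_atTop_zero
      have h2 : Tendsto (fun j => |a j - L|) atTop (𝓝 0) := by
        simpa [Real.dist_eq] using (tendsto_iff_dist_tendsto_zero.1 hL)
      simpa using h1.add (h2.const_mul (D : ℝ))
    have hr_le : ∀ j r, 0 < r → r ≤ ρ / 2 ^ j → ρ / 2 ^ j ≤ 2 * r →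
        ⨍ y in ball x r, |u y - L| ∂μ ≤ d j + D * |a j - L| := by
      intro j r h1 h2 h3
      have hm := hμ.measure_ball hx _ (hr j) (hr' j)
      calc ⨍ y in ball x r, |u y - L| ∂μ ≤ D * ⨍ y in ball x (ρ / 2 ^ j), |u y - L| ∂μ :=
            setAverage_le_mul_setAverage (ball_subset_ball h2) (fun _ => abs_nonneg _)
              (integrableOn_abs_sub_const L (hu _ (hr' _)) hm.2) (hcomp j r h1 h2 h3)
              (hμ.measure_ball hx r h1 (h2.trans (hr' j))).1 hm.2
        _ ≤ D * (o j + |a j - L|) := by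
            gcongr
            exact setAverage_abs_sub_le_add _ _ (hu _ (hr' _)) hm.1 hm.2
        _ ≤ _ := by rw [mul_add]; gcongr; exact hDo j
    rw [IsLebesgueValue, Metric.tendsto_nhds]
    intro ε hε
    obtain ⟨N, hN⟩ := eventually_atTop.1 (hbound.eventually_lt_const hε)
    -- An arbitrary small r is placed between ρ/2^{n+1} and ρ/2^n, and doubling compares its ball
    -- with the larger dyadic one.
    filter_upwards [Ioc_mem_nhdsGT (hr N)] with r hr0
    have h1 : 0 < r / ρ := div_pos hr0.1 hρ
    have h2 : r / ρ ≤ 1 := (div_le_one hρ).2 (hr0.2.trans (hr' N))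
    obtain ⟨n, hn1, hn2⟩ := exists_nat_pow_near_of_lt_one h1 h2 (y := (1 / 2 : ℝ)) (by norm_num)
      (by norm_num)
    rw [lt_div_iff₀ hρ, one_div_pow] at hn1
    rw [div_le_iff₀ hρ, one_div_pow] at hn2
    have hn1' : ρ / 2 ^ (n + 1) < r := by rw [div_eq_mul_inv, mul_comm]; simpa using hn1
    have hn2' : r ≤ ρ / 2 ^ n := by rw [div_eq_mul_inv, mul_comm]; simpa using hn2
    have hnN : N ≤ n := by
      by_contra! hlt
      have : ρ / 2 ^ N ≤ ρ / 2 ^ (n + 1) := by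
        gcongr
        · norm_num
        · omega
      linarith [hr0.2]
    rw [Real.dist_eq, sub_zero, abs_of_nonneg setAverage_abs_nonneg]
    exact (hr_le n r hr0.1 hn2' (by rw [hhalf n]; linarith)).trans_lt (hN n hnN)
  · have h1 := dist_le_tsum_of_dist_le_of_tendsto d hstep hdsum hL n
    have h2 : (∑' m : ℕ, d (n + m)) = (∑' m : ℕ, (D * K * Φ (ρ / 2 ^ (n + m)))).toReal := by
      rw [ENNReal.tsum_toReal_eq]
      exact fun m => ENNReal.ne_top_of_tsum_ne_top hS' (n + m)
    rw [h2] at h1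
    rw [← ENNReal.tsum_mul_left]
    rw [dist_comm] at h1
    exact (ENNReal.ofReal_le_ofReal h1).trans ENNReal.ofReal_toReal_le

/-- Both balls lie in B(x,2r), and B(x,2r) ⊆ B(y,4r); this is the origin of the enlargement factor 4
for μ. -/
theorem abs_setAverage_ball_sub_le (hμ : EnlargementBoundOn μ E 4 ρ D) {x y : X}
    (hx : x ∈ E) (hy : y ∈ E) {r : ℝ} (hr : 0 < r) (hr' : 2 * r ≤ ρ) (hxy : dist x y < r)
    (hu : IntegrableOn u (ball x (2 * r)) μ) :
    |(⨍ z in ball x r, u z ∂μ) - ⨍ z in ball y r, u z ∂μ| ≤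
      2 * D * ⨍ z in ball x (2 * r), |u z - ⨍ w in ball x (2 * r), u w ∂μ| ∂μ := by
  have hsub : ball y r ⊆ ball x (2 * r) := ball_subset_ball' (by rw [dist_comm]; linarith)
  have hsub' : ball x (2 * r) ⊆ ball y (4 * r) := ball_subset_ball' (by linarith)
  have hm := hμ.measure_ball hx (2 * r) (by linarith) hr'
  have h1 := abs_setAverage_sub_setAverage_le (ball_subset_ball (by linarith)) hu
    (hμ.ball_subset_ball_le hx hr (by linarith) le_rfl hr')
    (hμ.measure_ball hx r hr (by linarith)).1 hm.2
  have h2 := abs_setAverage_sub_setAverage_le hsub hu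
    ((measure_mono hsub').trans (hμ y hy r hr (by linarith)).2.1)
    (hμ.measure_ball hy r hr (by linarith)).1 hm.2
  rw [abs_sub_comm] at h2
  have := abs_sub_le (⨍ z in ball x r, u z ∂μ) (⨍ z in ball x (2 * r), u z ∂μ)
    (⨍ z in ball y r, u z ∂μ)
  linarith

end Telescope

/-! ### Fractional averages and the dyadic maximal function -/

theorem fracAvg_le_dyadicMax (μ m : Measure X) (α p lam ρ ε : ℝ) (x : X) (j : ℕ) :
    fracAvg μ m α p lam (ρ / 2 ^ j) x ≤
      ENNReal.ofReal ((2 ^ j : ℝ) ^ (-ε)) * dyadicMax μ m α p lam ρ ε x := by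
  have h2 : (0 : ℝ) < 2 ^ j := by positivity
  calc fracAvg μ m α p lam (ρ / 2 ^ j) x = ENNReal.ofReal ((2 ^ j : ℝ) ^ (-ε)) *
        (ENNReal.ofReal ((2 ^ j : ℝ) ^ ε) * fracAvg μ m α p lam (ρ / 2 ^ j) x) := by
        rw [← mul_assoc, ← ENNReal.ofReal_mul (Real.rpow_nonneg h2.le _), ← Real.rpow_add h2]
        simp
    _ ≤ _ := by
        gcongr
        exact le_iSup (fun j : ℕ => ENNReal.ofReal ((2 ^ j : ℝ) ^ ε) *
          fracAvg μ m α p lam (ρ / 2 ^ j) x) j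

/-- The weight in the maximal function turns the tail into a geometric series of ratio 2^{-ε}, so
the constant depends on ε alone. -/
theorem exists_tsum_fracAvg_le_dyadicMax {ε : ℝ} (hε : 0 < ε) :
    ∃ C : ℝ≥0, ∀ (μ m : Measure X) (α p lam ρ : ℝ) (x : X) (n : ℕ),
      ∑' j : ℕ, fracAvg μ m α p lam (ρ / 2 ^ (n + j)) x ≤
        C * ENNReal.ofReal ((2 ^ n : ℝ) ^ (-ε)) * dyadicMax μ m α p lam ρ ε x := by
  have h2ε : 0 ≤ (2 : ℝ) ^ (-ε) := by positivity
  have hlt : ENNReal.ofReal ((2 : ℝ) ^ (-ε)) < 1 := by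
    rw [ENNReal.ofReal_lt_one]
    exact Real.rpow_lt_one_of_one_lt_of_neg one_lt_two (by linarith)
  have hS : ∑' j : ℕ, ENNReal.ofReal ((2 : ℝ) ^ (-ε)) ^ j ≠ ∞ := by
    rw [ENNReal.tsum_geometric]
    exact ENNReal.inv_ne_top.2 (tsub_pos_of_lt hlt).ne'
  refine ⟨(∑' j : ℕ, ENNReal.ofReal ((2 : ℝ) ^ (-ε)) ^ j).toNNReal, fun μ m α p lam ρ x n => ?_⟩
  rw [ENNReal.coe_toNNReal hS, ← ENNReal.tsum_mul_right, ← ENNReal.tsum_mul_right]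
  refine ENNReal.tsum_le_tsum fun j => (fracAvg_le_dyadicMax μ m α p lam ρ ε x (n + j)).trans ?_
  gcongr
  rw [← ENNReal.ofReal_pow h2ε, ← ENNReal.ofReal_mul (by positivity), pow_add,
    Real.mul_rpow (by positivity) (by positivity), mul_comm, ← Real.rpow_natCast (2 ^ (-ε)) j,
    ← Real.rpow_mul zero_le_two, ← Real.rpow_natCast 2 j, ← Real.rpow_mul zero_le_two,
    mul_comm (-ε)]

end Telescoping

section Embeddings

variable {X : Type*} [MeasurableSpace X] [MetricSpace X]

/-! ### Embeddings below the critical exponent -/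

/-- Standing assumptions: both measures are doubling at scales up to `ρ`, and they are in balance
at the exponent `q₁ > p` with a gain `ε > 0`. -/
structure SubcriticalSetting (μ ν : Measure X) (E : Set X) (p α lam ρ q₁ β ε : ℝ)
    (D A : ℝ≥0) : Prop where
  doubling : EnlargementBoundOn μ E 4 ρ D
  enlarge : EnlargementBoundOn ν E (6 * lam) ρ D
  totallyBounded : TotallyBounded E
  nullMeasurableSet : NullMeasurableSet E ν
  one_le_p : 1 ≤ p
  one_le_lam : 1 ≤ lam
  ρ_pos : 0 < ρ
  ε_pos : 0 < ε
  p_lt : p < q₁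
  balance : MassBalanceOn μ ν E p q₁ β ρ A
  ε_mul : ε * q₁ = α * q₁ + β
  lower : ∀ r : ℝ, 0 < r → r ≤ ρ → ∃ c : ℝ≥0, c ≠ 0 ∧ ∀ x ∈ E, (c : ℝ≥0∞) ≤ μ (ball x r)

/-- `u` is integrable on balls and its mean oscillation on small balls centred in `E` is
controlled by the fractional averages of the measure `m`. -/
def OscillationBoundOn (μ : Measure X) (E : Set X) (p α lam ρ : ℝ) (K : ℝ≥0) (u : X → ℝ)
    (m : Measure X) : Prop :=
  (∀ x r, IntegrableOn u (ball x r) μ) ∧ ∀ x ∈ E, ∀ r : ℝ, 0 < r → r ≤ ρ →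
    ENNReal.ofReal (⨍ y in ball x r, |u y - ⨍ z in ball x r, u z ∂μ| ∂μ) ≤
      K * fracAvg μ m α p lam r x

omit [MetricSpace X] in
theorem eLpNorm_le_of_enorm_le_mul_add {ν : Measure X} {q : ℝ} (hq : 1 ≤ q) {f : X → ℝ}
    {h : X → ℝ≥0∞} {c d : ℝ≥0∞} (hh : AEMeasurable h ν)
    (hf : ∀ᵐ x ∂ν, ‖f x‖ₑ ≤ c * h x + d) :
    eLpNorm f (ENNReal.ofReal q) ν ≤
      c * (∫⁻ x, h x ^ q ∂ν) ^ (1 / q) + d * ν univ ^ (1 / q) := by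
  have hq0 : 0 < q := by linarith
  rw [eLpNorm_eq_lintegral_rpow_enorm_toReal (by simpa using hq0) ENNReal.ofReal_ne_top,
    ENNReal.toReal_ofReal hq0.le]
  calc (∫⁻ x, ‖f x‖ₑ ^ q ∂ν) ^ (1 / q)
      ≤ (∫⁻ x, ((fun x => c * h x) + fun _ => d : X → ℝ≥0∞) x ^ q ∂ν) ^ (1 / q) := by
        gcongr ?_ ^ (1 / q)
        refine lintegral_mono_ae ?_
        filter_upwards [hf] with x hx
        gcongr
        exact hx
    _ ≤ (∫⁻ x, (c * h x) ^ q ∂ν) ^ (1 / q) + (∫⁻ _, d ^ q ∂ν) ^ (1 / q) :=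
        ENNReal.lintegral_Lp_add_le (hh.const_mul c) aemeasurable_const hq
    _ = _ := by
        simp_rw [ENNReal.mul_rpow_of_nonneg _ _ hq0.le]
        rw [lintegral_const_mul'' _ (hh.pow_const q), lintegral_const,
          ENNReal.mul_rpow_of_nonneg _ _ (by positivity),
          ENNReal.mul_rpow_of_nonneg _ _ (by positivity), ← ENNReal.rpow_mul, ← ENNReal.rpow_mul,
          mul_one_div_cancel hq0.ne', ENNReal.rpow_one, ENNReal.rpow_one]

namespace SubcriticalSetting

variable {μ ν : Measure X} {E : Set X} {p α lam ρ q₁ β ε : ℝ} {D A : ℝ≥0}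

theorem p_pos (S : SubcriticalSetting μ ν E p α lam ρ q₁ β ε D A) : 0 < p := by
  linarith [S.one_le_p]

theorem measure_ne_top (S : SubcriticalSetting μ ν E p α lam ρ q₁ β ε D A) : ν E ≠ ∞ :=
  S.totallyBounded.measure_ne_top S.enlarge (by linarith [S.one_le_lam]) S.ρ_pos

theorem ae_mem (S : SubcriticalSetting μ ν E p α lam ρ q₁ β ε D A) :
    ∀ᵐ x ∂(ν.restrict E), x ∈ E := ae_restrict_mem₀ S.nullMeasurableSet

theorem radius_pos (S : SubcriticalSetting μ ν E p α lam ρ q₁ β ε D A) (j : ℕ) :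
    0 < ρ / 2 ^ j := by have := S.ρ_pos; positivity

theorem radius_le (S : SubcriticalSetting μ ν E p α lam ρ q₁ β ε D A) (j : ℕ) :
    ρ / 2 ^ j ≤ ρ := div_le_self S.ρ_pos.le (one_le_pow₀ one_le_two)

variable [OpensMeasurableSpace X]

theorem exists_lintegral_dyadicMax_le (S : SubcriticalSetting μ ν E p α lam ρ q₁ β ε D A)
    {q : ℝ} (hq : 0 < q) (hqq : q < q₁) :
    ∃ C : ℝ≥0, ∀ m : Measure X, ∀ τ : ℝ≥0, τ ≠ 0 → m univ ≤ (τ : ℝ≥0∞) ^ p →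
      ∫⁻ x in E, dyadicMax μ m α p lam ρ ε x ^ q ∂ν ≤ C * (τ : ℝ≥0∞) ^ q := by
  obtain ⟨C, hC⟩ := S.balance.exists_lintegral_dyadicMax_le S.enlarge S.nullMeasurableSet
    S.measure_ne_top S.one_le_lam S.ρ_pos S.p_pos S.p_lt.le S.ε_mul hq hqq
  exact ⟨C, fun m τ hτ hm => hC m τ (by simpa using hτ) ENNReal.coe_ne_top hm⟩

theorem ae_dyadicMax_ne_top (S : SubcriticalSetting μ ν E p α lam ρ q₁ β ε D A)
    {m : Measure X} {τ : ℝ≥0} (hτ : τ ≠ 0) (hm : m univ ≤ (τ : ℝ≥0∞) ^ p) :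
    ∀ᵐ x ∂(ν.restrict E), dyadicMax μ m α p lam ρ ε x ≠ ∞ := by
  obtain ⟨C, hC⟩ := S.exists_lintegral_dyadicMax_le zero_lt_one (S.one_le_p.trans_lt S.p_lt)
  have h := hC m τ hτ hm
  simp only [ENNReal.rpow_one] at h
  filter_upwards [ae_lt_top (measurable_dyadicMax ..) (ne_top_of_le_ne_top
    (ENNReal.mul_ne_top ENNReal.coe_ne_top ENNReal.coe_ne_top) h)] with x hx using hx.ne

omit [OpensMeasurableSpace X] in
-- Combines telescoping with the maximal function. The factor (2^n)^{-ε} is the uniform rate behind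
-- compactness.
theorem exists_abs_preciseRep_sub_le (S : SubcriticalSetting μ ν E p α lam ρ q₁ β ε D A)
    (K : ℝ≥0) :
    ∃ C : ℝ≥0, ∀ (u : X → ℝ) (m : Measure X), OscillationBoundOn μ E p α lam ρ K u m →
      ∀ x ∈ E, dyadicMax μ m α p lam ρ ε x ≠ ∞ →
        IsLebesgueValue μ u x (preciseRep μ u x) ∧
        preciseRepE μ u x = (preciseRep μ u x : EReal) ∧
        ∀ n : ℕ, ENNReal.ofReal |preciseRep μ u x - ⨍ y in ball x (ρ / 2 ^ n), u y ∂μ| ≤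
          C * ENNReal.ofReal ((2 ^ n : ℝ) ^ (-ε)) * dyadicMax μ m α p lam ρ ε x := by
  obtain ⟨C, hC⟩ := exists_tsum_fracAvg_le_dyadicMax (X := X) S.ε_pos
  refine ⟨D * K * C, fun u m hum x hx hM => ?_⟩
  have hS : ∑' j : ℕ, fracAvg μ m α p lam (ρ / 2 ^ j) x ≠ ∞ := by
    have := hC μ m α p lam ρ x 0
    simp only [zero_add] at this
    exact ne_top_of_le_ne_top (ENNReal.mul_ne_top (ENNReal.mul_ne_top ENNReal.coe_ne_top
      ENNReal.ofReal_ne_top) hM) this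
  obtain ⟨L, hL, hLn⟩ := exists_isLebesgueValue S.doubling S.ρ_pos hx
    (fun r _ => hum.1 x r)
    (Φ := fun r => fracAvg μ m α p lam r x) (hum.2 x hx) hS
  have ht := hL.tendsto_setAverage (fun r _ => hum.1 x r) S.ρ_pos (S.doubling.measure_ball hx)
  rw [preciseRep_eq_of_tendsto ht, preciseRepE_eq_of_tendsto ht]
  refine ⟨hL, rfl, fun n => (hLn n).trans ?_⟩
  push_cast
  rw [mul_assoc _ (C : ℝ≥0∞), mul_assoc]
  simp only [mul_assoc]
  gcongr
  simpa only [mul_assoc] using hC μ m α p lam ρ x n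

theorem aemeasurable_preciseRep (S : SubcriticalSetting μ ν E p α lam ρ q₁ β ε D A)
    {K : ℝ≥0} {u : X → ℝ} {m : Measure X} (hum : OscillationBoundOn μ E p α lam ρ K u m)
    {τ : ℝ≥0} (hτ : τ ≠ 0) (hm : m univ ≤ (τ : ℝ≥0∞) ^ p) :
    AEMeasurable (preciseRep μ u) (ν.restrict E) := by
  obtain ⟨C, hC⟩ := S.exists_abs_preciseRep_sub_le K
  refine aemeasurable_of_tendsto_metrizable_ae (𝓝[>] (0 : ℝ))
    (f := fun r x => ⨍ y in ball x r, u y ∂μ)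
    (fun r => (measurable_setAverage_ball fun x => hum.1 x r).aemeasurable) ?_
  filter_upwards [S.ae_mem, S.ae_dyadicMax_ne_top hτ hm] with x hx hM
  exact (hC u m hum x hx hM).1.tendsto_setAverage (fun r _ => hum.1 x r) S.ρ_pos (S.doubling.measure_ball hx)

omit [OpensMeasurableSpace X] in
-- At a fixed radius the balls have μ-mass bounded below on E, so the crude estimate m(λB) ≤ m(X)
-- suffices.
theorem exists_fracAvg_le (S : SubcriticalSetting μ ν E p α lam ρ q₁ β ε D A)
    {r : ℝ} (hr : 0 < r) (hr' : r ≤ ρ) :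
    ∃ C : ℝ≥0, ∀ (m : Measure X) (τ : ℝ≥0), m univ ≤ (τ : ℝ≥0∞) ^ p → ∀ x ∈ E,
      fracAvg μ m α p lam r x ≤ C * τ := by
  obtain ⟨c, hc, hcx⟩ := S.lower r hr hr'
  have hp := S.p_pos
  have hc' : ((c : ℝ≥0∞)⁻¹) ^ (1 / p) ≠ ∞ :=
    ENNReal.rpow_ne_top_of_nonneg (by positivity) (ENNReal.inv_ne_top.2 (by simpa using hc))
  refine ⟨(r ^ α).toNNReal * (((c : ℝ≥0∞)⁻¹) ^ (1 / p)).toNNReal, fun m τ hm x hx => ?_⟩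
  push_cast
  rw [ENNReal.coe_toNNReal hc', fracAvg, ENNReal.mul_rpow_of_nonneg _ _ (by positivity),
    ← mul_assoc]
  gcongr
  · exact le_rfl
  · exact hcx x hx
  · calc m (ball x (lam * r)) ^ (1 / p) ≤ ((τ : ℝ≥0∞) ^ p) ^ (1 / p) := by
          gcongr
          exact (measure_mono (subset_univ _)).trans hm
      _ = τ := by rw [← ENNReal.rpow_mul, mul_one_div_cancel hp.ne', ENNReal.rpow_one]

omit [OpensMeasurableSpace X] in
/-- Two-point estimate for averages at comparable centres. -/
theorem ofReal_abs_setAverage_sub_le (S : SubcriticalSetting μ ν E p α lam ρ q₁ β ε D A)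
    {K : ℝ≥0} {u : X → ℝ} {m : Measure X} (hum : OscillationBoundOn μ E p α lam ρ K u m)
    {x y : X} (hx : x ∈ E) (hy : y ∈ E) (n : ℕ) (hxy : dist x y < ρ / 2 ^ (n + 1)) :
    ENNReal.ofReal |(⨍ z in ball x (ρ / 2 ^ (n + 1)), u z ∂μ) -
        ⨍ z in ball y (ρ / 2 ^ (n + 1)), u z ∂μ| ≤
      2 * D * K * fracAvg μ m α p lam (ρ / 2 ^ n) x := by
  have h2 : 2 * (ρ / 2 ^ (n + 1)) = ρ / 2 ^ n := by rw [pow_succ]; field_simp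
  have h := abs_setAverage_ball_sub_le S.doubling hx hy (S.radius_pos (n + 1))
    (by rw [h2]; exact S.radius_le n) hxy (hum.1 x _)
  rw [h2] at h
  refine (ENNReal.ofReal_le_ofReal h).trans ?_
  rw [ENNReal.ofReal_mul (by positivity), ENNReal.ofReal_mul zero_le_two, mul_assoc (2 * _)]
  simp only [ENNReal.ofReal_ofNat, ENNReal.ofReal_coe_nnreal]
  gcongr
  exact hum.2 x hx _ (S.radius_pos n) (S.radius_le n)

end SubcriticalSetting

end Embeddings

/-! ### Averages at a fixed scale, controlled by either norm -/

section Means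

variable {X : Type*} [MeasurableSpace X] [MetricSpace X]

/-- The averages of `|u|` over balls of radius `r`, at almost every centre in `E`, are bounded by
`C` times the norm of `u`, for all `u ∈ Y`. -/
def MeanBoundOn (μ ν : Measure X) (E : Set X) (Y : Set (X → ℝ)) (N : (X → ℝ) → ℝ≥0∞) (r : ℝ)
    (C : ℝ≥0) : Prop :=
  ∀ᵐ x ∂(ν.restrict E), ∀ u ∈ Y, ∀ τ : ℝ≥0, τ ≠ 0 → N u ≤ τ →
    ⨍ y in ball x r, |u y| ∂μ ≤ C * τ

namespace SubcriticalSetting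

variable {μ ν : Measure X} {E : Set X} {p α lam ρ q₁ β ε : ℝ} {D A : ℝ≥0}

theorem exists_meanBoundOn_normOnX (S : SubcriticalSetting μ ν E p α lam ρ q₁ β ε D A)
    (Y : Set (X → ℝ)) (G : (X → ℝ) → (X → ℝ)) (n : ℕ) :
    ∃ C : ℝ≥0, MeanBoundOn μ ν E Y (normOnX μ p G) (ρ / 2 ^ n) C := by
  obtain ⟨c, hc, hcx⟩ := S.lower _ (S.radius_pos n) (S.radius_le n)
  refine ⟨c⁻¹, ?_⟩
  filter_upwards [S.ae_mem] with x hx u _ τ _ hN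
  have h : ENNReal.ofReal (⨍ y in ball x (ρ / 2 ^ n), |u y| ∂μ) ≤
      ENNReal.ofReal ((c⁻¹ : ℝ≥0) * τ) := by
    rw [ENNReal.ofReal_mul (by positivity), ENNReal.ofReal_coe_nnreal, ENNReal.ofReal_coe_nnreal,
      ENNReal.coe_inv hc]
    calc _ ≤ ‖⨍ y in ball x (ρ / 2 ^ n), |u y| ∂μ‖ₑ := by
          rw [Real.enorm_eq_ofReal_abs]
          exact ENNReal.ofReal_le_ofReal (le_abs_self _)
      _ ≤ (μ (ball x (ρ / 2 ^ n)))⁻¹ * ∫⁻ y in ball x (ρ / 2 ^ n), ‖|u y|‖ₑ ∂μ :=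
          enorm_setAverage_le _
      _ ≤ (c : ℝ≥0∞)⁻¹ * eLpNorm u 1 μ := by
          rw [eLpNorm_one_eq_lintegral_enorm]
          simp only [Real.enorm_eq_ofReal_abs, abs_abs]
          gcongr
          · exact hcx x hx
          · exact Measure.restrict_le_self
      _ ≤ _ := by
          gcongr
          exact le_self_add.trans hN
  exact (ENNReal.ofReal_le_ofReal_iff (by positivity)).1 h

variable [OpensMeasurableSpace X]

/-- The norm sees only ū on E, so the average b of u over B(x,r) is compared with ū(z) for z in a
patch of E near x, at the cost of M(z) and a multiple of τ. Integrating over the patch and dividing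
by its ν-measure bounds b; finitely many patches cover E, so one constant serves for all x. -/
theorem exists_meanBoundOn_normOnE (S : SubcriticalSetting μ ν E p α lam ρ q₁ β ε D A)
    {Y : Set (X → ℝ)} {G : (X → ℝ) → (X → ℝ)} {K : ℝ≥0}
    (hY : ∀ u ∈ Y, OscillationBoundOn μ E p α lam ρ K u (gradMeasure μ p (G u))) (n : ℕ) :
    ∃ C : ℝ≥0, MeanBoundOn μ ν E Y (normOnE μ ν E p G) (ρ / 2 ^ (n + 1)) C := by
  set r := ρ / 2 ^ (n + 1) with hr_def
  have hr : 0 < r := S.radius_pos _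
  obtain ⟨t, htE, htf, ht⟩ := S.totallyBounded.exists_subset
    (Metric.dist_mem_uniformity (half_pos hr))
  obtain ⟨C1, hC1⟩ := S.exists_abs_preciseRep_sub_le K
  obtain ⟨C2, hC2⟩ := S.exists_fracAvg_le (S.radius_pos n) (S.radius_le n)
  obtain ⟨C3, hC3⟩ := S.exists_fracAvg_le hr (S.radius_le (n + 1))
  obtain ⟨C4, hC4⟩ := S.exists_lintegral_dyadicMax_le zero_lt_one (S.one_le_p.trans_lt S.p_lt)
  set c1 : ℝ≥0 := C1 * ((2 ^ (n + 1) : ℝ) ^ (-ε)).toNNReal with hc1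
  set c3 : ℝ≥0 := 2 * D * K * C2 with hc3
  -- Null patches contribute 0 here, since 0⁻¹ = 0 in `ℝ≥0`.
  set C0 : ℝ≥0 := ∑ y ∈ htf.toFinset, ((ν (ball y (r / 2) ∩ E)).toNNReal)⁻¹ with hC0
  -- Points in null patches are discarded. There are finitely many patches, so the exceptional set
  -- does not depend on u.
  have hnull : ∀ᵐ x ∂(ν.restrict E), ∀ y ∈ t, ν (ball y (r / 2) ∩ E) = 0 → x ∉ ball y (r / 2) := by
    rw [ae_ball_iff htf.countable]
    intro y _
    by_cases h0 : ν (ball y (r / 2) ∩ E) = 0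
    · have : (ν.restrict E) (ball y (r / 2)) = 0 := by
        rwa [Measure.restrict_apply₀' S.nullMeasurableSet]
      filter_upwards [measure_eq_zero_iff_ae_notMem.1 this] with x hx _ using hx
    · exact Eventually.of_forall fun _ h => absurd h h0
  refine ⟨K * C3 + C0 * (1 + c1 * C4 + c3 * (ν E).toNNReal), ?_⟩
  filter_upwards [S.ae_mem, hnull] with x hx hxnull u huY τ hτ hN
  have hu := hY u huY
  have hm : gradMeasure μ p (G u) univ ≤ (τ : ℝ≥0∞) ^ p :=
    gradMeasure_univ_le S.one_le_p (le_add_self.trans hN)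
  set m := gradMeasure μ p (G u) with hm_def
  obtain ⟨y, hyt, hxy⟩ := mem_iUnion₂.1 (ht hx)
  have hxy' : x ∈ ball y (r / 2) := hxy
  set P := ball y (r / 2) ∩ E with hP
  have hP0 : ν P ≠ 0 := fun h0 => hxnull y hyt h0 hxy'
  have hPtop : ν P ≠ ∞ := ne_top_of_le_ne_top S.measure_ne_top (measure_mono inter_subset_right)
  have hPm : NullMeasurableSet P ν := measurableSet_ball.nullMeasurableSet.inter S.nullMeasurableSet
  set b := ⨍ z in ball x r, u z ∂μ with hb
  have hae : ∀ᵐ z ∂(ν.restrict P), ENNReal.ofReal |b| ≤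
      ‖preciseRep μ u z‖ₑ + c1 * dyadicMax μ m α p lam ρ ε z + c3 * τ := by
    have hle : ν.restrict P ≤ ν.restrict E := Measure.restrict_mono inter_subset_right le_rfl
    filter_upwards [ae_restrict_mem₀ hPm, ae_mono hle (S.ae_dyadicMax_ne_top hτ hm)] with z hz hzM
    have hxz : dist x z < r := by
      have h1 := mem_ball.1 hxy'
      have h2 := mem_ball.1 hz.1
      have h3 := dist_triangle_right x z y
      linarith
    have h1 := S.ofReal_abs_setAverage_sub_le hu hx hz.2 n hxz
    have h2 := (hC1 u m hu z hz.2 hzM).2.2 (n + 1)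
    rw [← hr_def] at h1 h2
    have h3 : |b| ≤ |preciseRep μ u z| + |preciseRep μ u z - ⨍ w in ball z r, u w ∂μ| +
        |b - ⨍ w in ball z r, u w ∂μ| := by
      have e : b = preciseRep μ u z - (preciseRep μ u z - ⨍ w in ball z r, u w ∂μ) +
        (b - ⨍ w in ball z r, u w ∂μ) := by ring
      calc |b| = |preciseRep μ u z - (preciseRep μ u z - ⨍ w in ball z r, u w ∂μ) +
            (b - ⨍ w in ball z r, u w ∂μ)| := by rw [← e]
        _ ≤ _ := (abs_add_le _ _).trans (by gcongr; exact abs_sub _ _)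
    refine (ENNReal.ofReal_le_ofReal h3).trans ?_
    rw [ENNReal.ofReal_add (by positivity) (by positivity),
      ENNReal.ofReal_add (by positivity) (by positivity), Real.enorm_eq_ofReal_abs]
    gcongr
    · refine h2.trans (le_of_eq ?_)
      rw [hc1, ENNReal.coe_mul, ENNReal.ofReal]
    · refine h1.trans ?_
      rw [hc3]
      push_cast
      rw [mul_assoc _ (C2 : ℝ≥0∞)]
      gcongr
      exact hC2 m τ hm x hx
  have hint : ENNReal.ofReal |b| * ν P ≤ (1 + c1 * C4 + c3 * ν E) * τ := by
    calc ENNReal.ofReal |b| * ν P = ∫⁻ _ in P, ENNReal.ofReal |b| ∂ν := by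
          rw [setLIntegral_const]
      _ ≤ ∫⁻ z in P, (‖preciseRep μ u z‖ₑ + c1 * dyadicMax μ m α p lam ρ ε z + c3 * τ) ∂ν :=
          lintegral_mono_ae hae
      _ ≤ ∫⁻ z in E, (‖preciseRep μ u z‖ₑ + c1 * dyadicMax μ m α p lam ρ ε z + c3 * τ) ∂ν :=
          lintegral_mono_set inter_subset_right
      _ = (∫⁻ z in E, ‖preciseRep μ u z‖ₑ ∂ν) + c1 * ∫⁻ z in E, dyadicMax μ m α p lam ρ ε z ∂ν +
          c3 * τ * ν E := by
          rw [lintegral_add_right _ measurable_const,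
            lintegral_add_right _ ((measurable_dyadicMax ..).const_mul _),
            lintegral_const_mul _ (measurable_dyadicMax ..), setLIntegral_const]
      _ ≤ τ + c1 * (C4 * τ) + c3 * τ * ν E := by
          gcongr
          · rw [← eLpNorm_one_eq_lintegral_enorm]
            exact le_self_add.trans hN
          · simpa only [ENNReal.rpow_one] using hC4 m τ hτ hm
      _ = _ := by ring
  have hbτ : ENNReal.ofReal |b| ≤ C0 * (1 + c1 * C4 + c3 * ν E) * τ := by
    have hle : (ν P)⁻¹ ≤ C0 := by
      have h1 : ((ν P).toNNReal)⁻¹ ≤ C0 :=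
        Finset.single_le_sum (f := fun y => ((ν (ball y (r / 2) ∩ E)).toNNReal)⁻¹)
          (fun _ _ => zero_le) (htf.mem_toFinset.2 hyt)
      have h2 : (ν P)⁻¹ = (((ν P).toNNReal)⁻¹ : ℝ≥0) := by
        rw [ENNReal.coe_inv (ENNReal.toNNReal_ne_zero.2 ⟨hP0, hPtop⟩), ENNReal.coe_toNNReal hPtop]
      rw [h2]
      exact_mod_cast h1
    calc ENNReal.ofReal |b| = (ν P)⁻¹ * (ENNReal.ofReal |b| * ν P) := by
          rw [mul_comm (ENNReal.ofReal |b|), ← mul_assoc, ENNReal.inv_mul_cancel hP0 hPtop, one_mul]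
      _ ≤ C0 * ((1 + c1 * C4 + c3 * ν E) * τ) := by gcongr
      _ = _ := by ring
  have hmx := S.doubling.measure_ball hx r hr (S.radius_le _)
  have hfin : ⨍ y in ball x r, |u y| ∂μ ≤ (⨍ y in ball x r, |u y - b| ∂μ) + |b| := by
    simpa using setAverage_abs_sub_le_add b 0 (hu.1 x r) hmx.1 hmx.2
  have h : ENNReal.ofReal (⨍ y in ball x r, |u y| ∂μ) ≤
      ((K * C3 + C0 * (1 + c1 * C4 + c3 * (ν E).toNNReal) : ℝ≥0) : ℝ≥0∞) * τ := by
    refine (ENNReal.ofReal_le_ofReal hfin).trans ?_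
    rw [ENNReal.ofReal_add setAverage_abs_nonneg (abs_nonneg _)]
    push_cast
    rw [ENNReal.coe_toNNReal S.measure_ne_top, add_mul]
    gcongr
    refine (hu.2 x hx r hr (S.radius_le _)).trans ?_
    rw [mul_assoc]
    gcongr
    exact hC3 m τ hm x hx
  rw [← ENNReal.coe_mul, ← ENNReal.ofReal_coe_nnreal,
    ENNReal.ofReal_le_ofReal_iff (by positivity)] at h
  simpa using h

end SubcriticalSetting

end Means

/-! ### Boundedness and compactness below the critical exponent -/

section Compactness

variable {X : Type*} [MeasurableSpace X] [MetricSpace X]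

/-- The estimates are proved for positive levels τ ≥ N u, and N u may vanish; taking τ = N u +
δ/(C+1) and letting δ tend to 0 removes this restriction. -/
theorem boundedEmbedding_of_forall_le {μ ν : Measure X} {E : Set X} {q : ℝ} {Y : Set (X → ℝ)}
    {N : (X → ℝ) → ℝ≥0∞} (hEmb : EmbedsIn μ ν E q Y) (hN : ∀ u ∈ Y, N u < ∞)
    (h : ∃ C : ℝ≥0, ∀ u ∈ Y, ∀ τ : ℝ≥0, τ ≠ 0 → N u ≤ τ →
      eLpNorm (preciseRep μ u) (ENNReal.ofReal q) (ν.restrict E) ≤ C * τ) :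
    BoundedEmbedding μ ν E q Y N := by
  obtain ⟨C, hC⟩ := h
  refine ⟨hEmb, C, fun u hu => ENNReal.le_of_forall_pos_le_add fun δ hδ _ => ?_⟩
  lift N u to ℝ≥0 using (hN u hu).ne with a ha
  have hδ' : 0 < δ / (C + 1) := by positivity
  refine (hC u hu (a + δ / (C + 1)) (by positivity) ?_).trans ?_
  · rw [← ha]
    exact_mod_cast le_self_add
  · have h1 : C * (δ / (C + 1)) ≤ δ := by
      rw [mul_div_assoc', div_le_iff₀ (by positivity), mul_comm]
      gcongr
      exact le_self_add
    rw [← ENNReal.coe_mul, mul_add]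
    push_cast
    gcongr
    exact_mod_cast h1

namespace SubcriticalSetting

variable {μ ν : Measure X} {E : Set X} {p α lam ρ q₁ β ε : ℝ} {D A : ℝ≥0}

variable [OpensMeasurableSpace X] {Y : Set (X → ℝ)} {G : (X → ℝ) → (X → ℝ)} {K : ℝ≥0}
  {N : (X → ℝ) → ℝ≥0∞}

/-- Almost everywhere |ū| ≤ c M + C₀τ, by telescoping from scale ρ/2^n and the mean bound there; M
has the strong type q and ν(E) is finite. -/
theorem exists_eLpNorm_preciseRep_le (S : SubcriticalSetting μ ν E p α lam ρ q₁ β ε D A)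
    (hY : ∀ u ∈ Y, OscillationBoundOn μ E p α lam ρ K u (gradMeasure μ p (G u)))
    (hNG : ∀ u, eLpNorm (G u) (ENNReal.ofReal p) μ ≤ N u) {n : ℕ} {C₀ : ℝ≥0}
    (hmean : MeanBoundOn μ ν E Y N (ρ / 2 ^ n) C₀) {q : ℝ} (hq : 1 ≤ q) (hqq : q < q₁) :
    ∃ C : ℝ≥0, ∀ u ∈ Y, ∀ τ : ℝ≥0, τ ≠ 0 → N u ≤ τ →
      eLpNorm (preciseRep μ u) (ENNReal.ofReal q) (ν.restrict E) ≤ C * τ := by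
  have hq0 : 0 < q := by linarith
  obtain ⟨C1, hC1⟩ := S.exists_abs_preciseRep_sub_le K
  obtain ⟨C2, hC2⟩ := S.exists_lintegral_dyadicMax_le hq0 hqq
  set c1 : ℝ≥0 := C1 * ((2 ^ n : ℝ) ^ (-ε)).toNNReal with hc1
  have hVtop : (ν E) ^ (1 / q) ≠ ∞ :=
    ENNReal.rpow_ne_top_of_nonneg (by positivity) S.measure_ne_top
  refine ⟨c1 * C2 ^ (1 / q) + C₀ * ((ν E) ^ (1 / q)).toNNReal, fun u hu τ hτ hN => ?_⟩
  have hm := gradMeasure_univ_le S.one_le_p ((hNG u).trans hN)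
  have hp : ∀ᵐ x ∂(ν.restrict E), ‖preciseRep μ u x‖ₑ ≤
      c1 * dyadicMax μ (gradMeasure μ p (G u)) α p lam ρ ε x + C₀ * τ := by
    filter_upwards [S.ae_mem, S.ae_dyadicMax_ne_top hτ hm, hmean] with x hx hM hxm
    have h1 := (hC1 u _ (hY u hu) x hx hM).2.2 n
    have hb := S.doubling.measure_ball hx _ (S.radius_pos n) (S.radius_le n)
    have h2 : |⨍ y in ball x (ρ / 2 ^ n), u y ∂μ| ≤ C₀ * τ := by
      have := abs_setAverage_sub_le 0 ((hY u hu).1 x (ρ / 2 ^ n)) hb.1 hb.2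
      simp only [sub_zero] at this
      exact this.trans (hxm u hu τ hτ hN)
    have h3 : |preciseRep μ u x| ≤ |preciseRep μ u x - ⨍ y in ball x (ρ / 2 ^ n), u y ∂μ| +
        |⨍ y in ball x (ρ / 2 ^ n), u y ∂μ| := by
      simpa using abs_sub_le (preciseRep μ u x) (⨍ y in ball x (ρ / 2 ^ n), u y ∂μ) 0
    rw [Real.enorm_eq_ofReal_abs]
    refine (ENNReal.ofReal_le_ofReal h3).trans ?_
    rw [ENNReal.ofReal_add (abs_nonneg _) (abs_nonneg _)]
    refine add_le_add (h1.trans (le_of_eq ?_)) ?_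
    · rw [hc1, ENNReal.coe_mul, ENNReal.ofReal]
    · rw [← ENNReal.coe_mul, ← ENNReal.ofReal_coe_nnreal]
      exact ENNReal.ofReal_le_ofReal (by simpa using h2)
  refine (eLpNorm_le_of_enorm_le_mul_add hq (measurable_dyadicMax ..).aemeasurable hp).trans ?_
  push_cast
  rw [ENNReal.coe_toNNReal hVtop, Measure.restrict_apply_univ, add_mul]
  refine add_le_add ?_ (le_of_eq (by ring))
  rw [mul_assoc]
  gcongr
  calc _ ≤ (C2 * (τ : ℝ≥0∞) ^ q) ^ (1 / q) := by gcongr; exact hC2 _ τ hτ hm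
    _ = _ := by
      rw [ENNReal.mul_rpow_of_nonneg _ _ (by positivity), ← ENNReal.rpow_mul,
        mul_one_div_cancel hq0.ne', ENNReal.rpow_one,
        ENNReal.coe_rpow_of_nonneg _ (by positivity)]

theorem ae_finite_preciseRepE (S : SubcriticalSetting μ ν E p α lam ρ q₁ β ε D A)
    {u : X → ℝ} {m : Measure X} (hum : OscillationBoundOn μ E p α lam ρ K u m)
    {τ : ℝ≥0} (hτ : τ ≠ 0) (hm : m univ ≤ (τ : ℝ≥0∞) ^ p) :
    ∀ᵐ x ∂(ν.restrict E), preciseRepE μ u x ≠ ⊥ ∧ preciseRepE μ u x ≠ ⊤ := by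
  obtain ⟨C, hC⟩ := S.exists_abs_preciseRep_sub_le K
  filter_upwards [S.ae_mem, S.ae_dyadicMax_ne_top hτ hm] with x hx hM
  rw [(hC u m hum x hx hM).2.1]
  exact ⟨EReal.coe_ne_bot _, EReal.coe_ne_top _⟩

theorem embedsIn_of_forall_le (S : SubcriticalSetting μ ν E p α lam ρ q₁ β ε D A)
    (hY : ∀ u ∈ Y, OscillationBoundOn μ E p α lam ρ K u (gradMeasure μ p (G u)))
    (hNG : ∀ u, eLpNorm (G u) (ENNReal.ofReal p) μ ≤ N u) (hN : ∀ u ∈ Y, N u < ∞) {q : ℝ}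
    (h : ∃ C : ℝ≥0, ∀ u ∈ Y, ∀ τ : ℝ≥0, τ ≠ 0 → N u ≤ τ →
      eLpNorm (preciseRep μ u) (ENNReal.ofReal q) (ν.restrict E) ≤ C * τ) :
    EmbedsIn μ ν E q Y := by
  intro u hu
  obtain ⟨C, hC⟩ := h
  have hle : N u ≤ ((N u).toNNReal + 1 : ℝ≥0) := by
    rw [ENNReal.coe_add, ENNReal.coe_toNNReal (hN u hu).ne]
    exact le_self_add
  have hτ : (N u).toNNReal + 1 ≠ 0 := by positivity
  have hm := gradMeasure_univ_le S.one_le_p ((hNG u).trans hle)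
  exact ⟨S.ae_finite_preciseRepE (hY u hu) hτ hm,
    (S.aemeasurable_preciseRep (hY u hu) hτ hm).aestronglyMeasurable,
    (hC u hu _ hτ hle).trans_lt (by rw [← ENNReal.coe_mul]; exact ENNReal.coe_lt_top)⟩

omit [OpensMeasurableSpace X] in
/-- Comparison of two functions through their averages at nearby centres. -/
theorem exists_ofReal_abs_preciseRep_sub_le (S : SubcriticalSetting μ ν E p α lam ρ q₁ β ε D A)
    (K : ℝ≥0) :
    ∃ C : ℝ≥0, ∀ (u : X → ℝ) (m : Measure X), OscillationBoundOn μ E p α lam ρ K u m →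
      ∀ x ∈ E, dyadicMax μ m α p lam ρ ε x ≠ ∞ → ∀ n : ℕ, ∀ y ∈ E,
        dist x y < ρ / 2 ^ (n + 1) →
        ENNReal.ofReal |preciseRep μ u x - ⨍ z in ball y (ρ / 2 ^ (n + 1)), u z ∂μ| ≤
          C * ENNReal.ofReal ((2 ^ n : ℝ) ^ (-ε)) * dyadicMax μ m α p lam ρ ε x := by
  obtain ⟨C1, hC1⟩ := S.exists_abs_preciseRep_sub_le K
  refine ⟨C1 + 2 * D * K, fun u m hum x hx hM n y hy hxy => ?_⟩
  have h1 := (hC1 u m hum x hx hM).2.2 (n + 1)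
  have h2 := S.ofReal_abs_setAverage_sub_le hum hx hy n hxy
  have h3 := abs_sub_le (preciseRep μ u x) (⨍ z in ball x (ρ / 2 ^ (n + 1)), u z ∂μ)
    (⨍ z in ball y (ρ / 2 ^ (n + 1)), u z ∂μ)
  refine (ENNReal.ofReal_le_ofReal h3).trans ?_
  rw [ENNReal.ofReal_add (abs_nonneg _) (abs_nonneg _)]
  push_cast
  rw [add_mul, add_mul]
  refine add_le_add (h1.trans ?_) (h2.trans ?_)
  · have : ((2 ^ (n + 1) : ℝ)) ^ (-ε) ≤ (2 ^ n : ℝ) ^ (-ε) :=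
      Real.rpow_le_rpow_of_nonpos (by positivity)
        (pow_le_pow_right₀ one_le_two (Nat.le_succ n)) (by linarith [S.ε_pos])
    gcongr
  · rw [mul_assoc (2 * (D : ℝ≥0∞) * K)]
    gcongr
    exact fracAvg_le_dyadicMax μ m α p lam ρ ε x n

/-- Each function is encoded by its averages near finitely many points of E, rounded to multiples of
η. The averages are bounded, so there are finitely many codes; functions with equal codes differ by
C 2^{-nε}(M_k + M_l) + η almost everywhere, which is small in L^q. -/
theorem totallyBounded_range (S : SubcriticalSetting μ ν E p α lam ρ q₁ β ε D A)
    (hY : ∀ u ∈ Y, OscillationBoundOn μ E p α lam ρ K u (gradMeasure μ p (G u)))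
    (hNG : ∀ u, eLpNorm (G u) (ENNReal.ofReal p) μ ≤ N u)
    (hmean : ∀ n : ℕ, ∃ C : ℝ≥0, MeanBoundOn μ ν E Y N (ρ / 2 ^ (n + 1)) C)
    {q : ℝ} (hq : 1 ≤ q) (hqq : q < q₁) [Fact (1 ≤ ENNReal.ofReal q)] {f : ℕ → X → ℝ}
    (hf : ∀ k, f k ∈ Y) {τ : ℝ≥0} (hτ : τ ≠ 0) (hfN : ∀ k, N (f k) ≤ τ)
    (hmem : ∀ k, MemLp (preciseRep μ (f k)) (ENNReal.ofReal q) (ν.restrict E)) :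
    TotallyBounded (range fun k => (hmem k).toLp) := by
  classical
  have hq0 : 0 < q := by linarith
  obtain ⟨C1, hC1⟩ := S.exists_ofReal_abs_preciseRep_sub_le K
  obtain ⟨C2, hC2⟩ := S.exists_lintegral_dyadicMax_le hq0 hqq
  have hm : ∀ k, gradMeasure μ p (G (f k)) univ ≤ (τ : ℝ≥0∞) ^ p := fun k =>
    gradMeasure_univ_le S.one_le_p ((hNG _).trans (hfN k))
  set M : ℕ → X → ℝ≥0∞ := fun k => dyadicMax μ (gradMeasure μ p (G (f k))) α p lam ρ ε with hM
  set V : ℝ≥0 := ((ν E) ^ (1 / q)).toNNReal with hV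
  have hVtop : (ν E) ^ (1 / q) ≠ ∞ :=
    ENNReal.rpow_ne_top_of_nonneg (by positivity) S.measure_ne_top
  set B : ℝ≥0 := C2 ^ (1 / q) * τ with hB
  have hMB : ∀ k, (∫⁻ x in E, M k x ^ q ∂ν) ^ (1 / q) ≤ B := by
    intro k
    calc _ ≤ (C2 * (τ : ℝ≥0∞) ^ q) ^ (1 / q) := by gcongr; exact hC2 _ τ hτ (hm k)
      _ = _ := by
        rw [ENNReal.mul_rpow_of_nonneg _ _ (by positivity), ← ENNReal.rpow_mul,
          mul_one_div_cancel hq0.ne', ENNReal.rpow_one, hB, ENNReal.coe_mul,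
          ENNReal.coe_rpow_of_nonneg _ (by positivity)]
  refine totallyBounded_of_finite_discretization fun δ hδ => ?_
  obtain ⟨n, hn⟩ : ∃ n : ℕ, (C1 : ℝ) * (2 ^ n : ℝ) ^ (-ε) * (B + B) < δ / 4 := by
    have h1 : (2 : ℝ) ^ (-ε) < 1 :=
      Real.rpow_lt_one_of_one_lt_of_neg one_lt_two (by linarith [S.ε_pos])
    have h2 : Tendsto (fun n : ℕ => (C1 : ℝ) * ((2 : ℝ) ^ (-ε)) ^ n * (B + B)) atTop (𝓝 0) := by
      simpa using ((tendsto_pow_atTop_nhds_zero_of_lt_one (by positivity) h1).const_mul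
        (C1 : ℝ)).mul_const ((B : ℝ) + B)
    obtain ⟨n, hn⟩ := (h2.eventually_lt_const (show 0 < δ / 4 by linarith)).exists
    refine ⟨n, ?_⟩
    rwa [← Real.rpow_natCast 2 n, ← Real.rpow_mul zero_le_two, mul_comm (n : ℝ),
      Real.rpow_mul zero_le_two, Real.rpow_natCast]
  set r := ρ / 2 ^ (n + 1) with hr_def
  have hr : 0 < r := S.radius_pos _
  obtain ⟨C₀, hC₀⟩ := hmean n
  rw [← hr_def] at hC₀
  -- The constant η has L^q norm ηV ≤ δ/4; the maximal functions cost less than another δ/4.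
  set η : ℝ := δ / (4 * (V + 1)) with hη_def
  have hη : 0 < η := by positivity
  obtain ⟨t, htE, htf, ht⟩ := S.totallyBounded.exists_subset
    (Metric.dist_mem_uniformity (half_pos hr))
  let Good : X → Prop := fun x => x ∈ E ∧ ∀ k, ⨍ y in ball x r, |f k y| ∂μ ≤ C₀ * τ
  have hGood : ∀ᵐ x ∂(ν.restrict E), Good x := by
    filter_upwards [S.ae_mem, hC₀] with x hx hxm
    exact ⟨hx, fun k => hxm _ (hf k) τ hτ (hfN k)⟩
  -- The mean bound holds only almost everywhere and may fail at the centre y of a cell, so a good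
  -- point of the cell is used whenever one exists.
  have hz : ∀ y, ∃ z, (∃ z', z' ∈ ball y (r / 2) ∧ Good z') → z ∈ ball y (r / 2) ∧ Good z := by
    intro y
    by_cases h : ∃ z', z' ∈ ball y (r / 2) ∧ Good z'
    · exact ⟨h.choose, fun _ => h.choose_spec⟩
    · exact ⟨y, fun h' => absurd h' h⟩
  choose z hz using hz
  have : Fintype t := htf.fintype
  set a : ℕ → X → ℝ := fun k y => if Good (z y) then ⨍ w in ball (z y) r, f k w ∂μ else 0 with ha
  have haB : ∀ k y, |a k y| ≤ C₀ * τ := by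
    intro k y
    simp only [ha]
    split_ifs with h
    · have hb := S.doubling.measure_ball h.1 _ hr (S.radius_le _)
      have h1 := abs_setAverage_sub_le 0 ((hY _ (hf k)).1 (z y) r) hb.1 hb.2
      simp only [sub_zero] at h1
      exact h1.trans (h.2 k)
    · simp only [abs_zero]; positivity
  set Z : ℤ := ⌈(C₀ * τ : ℝ) / η⌉ with hZ
  have hfloor : ∀ k y, ⌊a k y / η⌋ ∈ Finset.Icc (-Z) Z := by
    intro k y
    have h1 := abs_le.1 (haB k y)
    have h2 : (C₀ * τ : ℝ) / η ≤ Z := Int.le_ceil _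
    rw [Finset.mem_Icc]
    constructor
    · rw [Int.le_floor]
      push_cast
      have : -((C₀ * τ : ℝ) / η) ≤ a k y / η := by
        rw [← neg_div]; gcongr; exact h1.1
      linarith
    · have h3 : a k y / η ≤ Z := le_trans (by gcongr; exact h1.2) h2
      exact_mod_cast (Int.floor_le _).trans h3
  choose! idx hidx using fun (w : Lp ℝ (ENNReal.ofReal q) (ν.restrict E))
    (hw : w ∈ range fun k => (hmem k).toLp) => hw
  refine ⟨t → Finset.Icc (-Z) Z, inferInstance,
    fun w y => ⟨⌊a (idx w) y / η⌋, hfloor _ _⟩, fun w₁ w₂ h => ?_⟩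
  rw [← hidx w₁ w₁.2, ← hidx w₂ w₂.2]
  set k := idx w₁
  set l := idx w₂
  -- Equal floors of the numbers divided by η force the averages to lie within η of each other.
  have hkl : ∀ y ∈ t, |a k y - a l y| ≤ η := by
    intro y hy
    have h1 := congrArg Subtype.val (congrFun h ⟨y, hy⟩)
    have h2 := Int.abs_sub_lt_one_of_floor_eq_floor h1
    rw [← sub_div, abs_div, abs_of_pos hη, div_lt_one hη] at h2
    exact h2.le
  have hpt : ∀ᵐ x ∂(ν.restrict E), ‖(preciseRep μ (f k) - preciseRep μ (f l)) x‖ₑ ≤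
      (C1 * ENNReal.ofReal ((2 ^ n : ℝ) ^ (-ε))) * (M k + M l) x + ENNReal.ofReal η := by
    filter_upwards [hGood, S.ae_dyadicMax_ne_top hτ (hm k), S.ae_dyadicMax_ne_top hτ (hm l)]
      with x hx hxk hxl
    obtain ⟨y, hyt, hxy⟩ := mem_iUnion₂.1 (ht hx.1)
    have hxy' : x ∈ ball y (r / 2) := hxy
    obtain ⟨hzy, hzG⟩ := hz y ⟨x, hxy', hx⟩
    have hxz : dist x (z y) < r := by
      have h1 := mem_ball.1 hxy'
      have h2 := mem_ball.1 hzy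
      have h3 := dist_triangle_right x (z y) y
      linarith
    have h1 := hC1 _ _ (hY _ (hf k)) x hx.1 hxk n (z y) hzG.1 hxz
    have h2 := hC1 _ _ (hY _ (hf l)) x hx.1 hxl n (z y) hzG.1 hxz
    have h3 := hkl y hyt
    simp only [ha, if_pos hzG] at h3
    rw [← hr_def] at h1 h2
    have h4 : |preciseRep μ (f k) x - preciseRep μ (f l) x| ≤
        |preciseRep μ (f k) x - ⨍ w in ball (z y) r, f k w ∂μ| +
        |preciseRep μ (f l) x - ⨍ w in ball (z y) r, f l w ∂μ| + η := by
      have e1 := abs_sub_le (preciseRep μ (f k) x) (⨍ w in ball (z y) r, f k w ∂μ)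
        (preciseRep μ (f l) x)
      have e2 := abs_sub_le (⨍ w in ball (z y) r, f k w ∂μ) (⨍ w in ball (z y) r, f l w ∂μ)
        (preciseRep μ (f l) x)
      rw [abs_sub_comm (⨍ w in ball (z y) r, f l w ∂μ) (preciseRep μ (f l) x)] at e2
      linarith
    rw [Pi.sub_apply, Real.enorm_eq_ofReal_abs]
    refine (ENNReal.ofReal_le_ofReal h4).trans ?_
    rw [ENNReal.ofReal_add (by positivity) hη.le,
      ENNReal.ofReal_add (abs_nonneg _) (abs_nonneg _), Pi.add_apply, mul_add]
    gcongr
  have hmeas : ∀ k, Measurable (M k) := fun k => measurable_dyadicMax ..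
  have hfin := eLpNorm_le_of_enorm_le_mul_add hq ((hmeas k).add (hmeas l)).aemeasurable hpt
  rw [← edist_lt_ofReal, Lp.edist_toLp_toLp]
  refine hfin.trans_lt ?_
  have hadd : (∫⁻ x in E, (M k + M l) x ^ q ∂ν) ^ (1 / q) ≤ B + B :=
    (ENNReal.lintegral_Lp_add_le (hmeas k).aemeasurable (hmeas l).aemeasurable hq).trans
      (add_le_add (hMB k) (hMB l))
  have hηV : η * V ≤ δ / 4 := by
    rw [hη_def, div_mul_eq_mul_div, div_le_div_iff₀ (by positivity) (by positivity)]
    nlinarith [V.coe_nonneg]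
  calc _ ≤ (C1 * ENNReal.ofReal ((2 ^ n : ℝ) ^ (-ε))) * (B + B) + ENNReal.ofReal η * V := by
        rw [Measure.restrict_apply_univ, hV, ENNReal.coe_toNNReal hVtop]
        gcongr
    _ = ENNReal.ofReal (C1 * (2 ^ n : ℝ) ^ (-ε) * (B + B) + η * V) := by
        rw [ENNReal.ofReal_add (by positivity) (by positivity), ENNReal.ofReal_mul (by positivity),
          ENNReal.ofReal_mul (by positivity), ENNReal.ofReal_mul hη.le,
          ENNReal.ofReal_add (by positivity) (by positivity)]
        simp only [ENNReal.ofReal_coe_nnreal]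
    _ < ENNReal.ofReal δ := by
        rw [ENNReal.ofReal_lt_ofReal_iff hδ]
        linarith

theorem compactEmbedding (S : SubcriticalSetting μ ν E p α lam ρ q₁ β ε D A)
    (hY : ∀ u ∈ Y, OscillationBoundOn μ E p α lam ρ K u (gradMeasure μ p (G u)))
    (hNG : ∀ u, eLpNorm (G u) (ENNReal.ofReal p) μ ≤ N u) (hN : ∀ u ∈ Y, N u < ∞)
    (hmean : ∀ n : ℕ, ∃ C : ℝ≥0, MeanBoundOn μ ν E Y N (ρ / 2 ^ (n + 1)) C)
    {q : ℝ} (hq : 1 ≤ q) (hqq : q < q₁) : CompactEmbedding μ ν E q Y N := by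
  obtain ⟨C₀, hC₀⟩ := hmean 0
  have hEmb : EmbedsIn μ ν E q Y :=
    S.embedsIn_of_forall_le hY hNG hN (S.exists_eLpNorm_preciseRep_le hY hNG hC₀ hq hqq)
  refine ⟨hEmb, fun f hf ⟨M, hM⟩ => ?_⟩
  have : Fact (1 ≤ ENNReal.ofReal q) := ⟨ENNReal.one_le_ofReal.2 hq⟩
  have hmem := fun k => (hEmb (f k) (hf k)).2
  have htb := S.totallyBounded_range hY hNG hmean hq hqq hf (τ := M + 1) (by positivity)
    (fun k => (hM k).trans (by exact_mod_cast le_self_add)) hmem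
  obtain ⟨v, -, φ, hφ, hv⟩ := (htb.closure.isCompact_of_isClosed
    isClosed_closure).tendsto_subseq fun k => subset_closure (mem_range_self k)
  refine ⟨φ, hφ, v, Lp.memLp v, ?_⟩
  rw [Lp.tendsto_Lp_iff_tendsto_eLpNorm'] at hv
  refine hv.congr fun n => eLpNorm_congr_ae ?_
  filter_upwards [(hmem (φ n)).coeFn_toLp] with x hx
  simp [hx]

end SubcriticalSetting

end Compactness

section Hedberg

/-! ### A Hedberg type summation lemma -/

/-- The sum is split at the first index J with a_J ≤ 1. Before J the term is a_j^{-b}, decaying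
geometrically as j moves back from J−1; from J on it is at most a_j^{c−b}, decaying geometrically
forwards. Neither bound depends on J. -/
theorem exists_tsum_min_rpow_le {b c C θ : ℝ} (hb : 0 < b) (hbc : b < c) (hC : 0 < C)
    (hθ : 0 < θ) (hθ1 : θ < 1) :
    ∃ B : ℝ≥0, ∀ a : ℕ → ℝ, (∀ j, 0 < a j) → (∀ j k, a (j + k) ≤ C * θ ^ k * a j) →
      ∑' j, ENNReal.ofReal (a j ^ (-b) * min 1 (a j) ^ c) ≤ B := by
  have hgeo : ∀ e : ℝ, 0 < e → ∀ M : ℝ, 0 < M →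
      ∑' j : ℕ, ENNReal.ofReal (M * (θ ^ e) ^ j) ≠ ∞ := by
    intro e he M hM
    have h1 : θ ^ e < 1 := Real.rpow_lt_one hθ.le hθ1 he
    exact ((summable_geometric_of_lt_one (by positivity) h1).mul_left M).tsum_ofReal_ne_top
  have h1 := hgeo b hb (C ^ b) (by positivity)
  have h2 := hgeo (c - b) (by linarith) (C ^ (c - b)) (by positivity)
  refine ⟨(∑' j : ℕ, ENNReal.ofReal (C ^ b * (θ ^ b) ^ j) +
    ∑' j : ℕ, ENNReal.ofReal (C ^ (c - b) * (θ ^ (c - b)) ^ j)).toNNReal, fun a ha hak => ?_⟩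
  rw [ENNReal.coe_toNNReal (ENNReal.add_ne_top.2 ⟨h1, h2⟩)]
  have hex : ∃ j, a j ≤ 1 := by
    have ht : Tendsto (fun k : ℕ => C * θ ^ k * a 0) atTop (𝓝 0) := by
      simpa using ((tendsto_pow_atTop_nhds_zero_of_lt_one hθ.le hθ1).const_mul C).mul_const (a 0)
    obtain ⟨k, hk⟩ := (ht.eventually_lt_const zero_lt_one).exists
    exact ⟨k, (by simpa using hak 0 k : a k ≤ _).trans hk.le⟩
  classical
  obtain ⟨J, hJ, hmin⟩ : ∃ J, a J ≤ 1 ∧ ∀ j < J, 1 < a j :=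
    ⟨Nat.find hex, Nat.find_spec hex, fun j hj => not_le.1 (Nat.find_min hex hj)⟩
  have hcomm : ∀ (e : ℝ) (k : ℕ), (C * θ ^ k) ^ e = C ^ e * (θ ^ e) ^ k := by
    intro e k
    rw [Real.mul_rpow hC.le (by positivity), ← Real.rpow_natCast θ k, ← Real.rpow_mul hθ.le,
      ← Real.rpow_natCast (θ ^ e) k, ← Real.rpow_mul hθ.le, mul_comm e]
  have hsplit := Summable.sum_add_tsum_nat_add' (k := J)
    (f := fun j => ENNReal.ofReal (a j ^ (-b) * min 1 (a j) ^ c)) ENNReal.summable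
  rw [← hsplit]
  refine add_le_add ?_ (ENNReal.tsum_le_tsum fun j => ENNReal.ofReal_le_ofReal ?_)
  · refine le_trans ?_ (ENNReal.sum_le_tsum (Finset.range J))
    rw [← Finset.sum_range_reflect (fun j => ENNReal.ofReal (C ^ b * (θ ^ b) ^ j))]
    refine Finset.sum_le_sum fun j hj => ENNReal.ofReal_le_ofReal ?_
    have hjJ := Finset.mem_range.1 hj
    have h3 := hak j (J - 1 - j)
    rw [show j + (J - 1 - j) = J - 1 by omega] at h3
    have h4 : 1 ≤ C * θ ^ (J - 1 - j) * a j := (hmin (J - 1) (by omega)).le.trans h3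
    rw [min_eq_left (hmin j hjJ).le, Real.one_rpow, mul_one, ← hcomm, Real.rpow_neg (ha j).le,
      inv_le_iff_one_le_mul₀ (Real.rpow_pos_of_pos (ha j) b),
      ← Real.mul_rpow (by positivity) (ha j).le]
    exact Real.one_le_rpow h4 hb.le
  · have h3 := hak J j
    rw [add_comm] at h3
    have h4 : a (j + J) ≤ C * θ ^ j :=
      h3.trans (mul_le_of_le_one_right (by positivity) hJ)
    have hpos := ha (j + J)
    calc a (j + J) ^ (-b) * min 1 (a (j + J)) ^ c ≤ a (j + J) ^ (-b) * a (j + J) ^ c := by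
          gcongr
          · linarith
          · exact min_le_right (1 : ℝ) _
      _ = a (j + J) ^ (c - b) := by rw [← Real.rpow_add hpos]; ring_nf
      _ ≤ (C * θ ^ j) ^ (c - b) := Real.rpow_le_rpow hpos.le h4 (by linarith)
      _ = _ := hcomm _ _

/-- Here n, mj and φ play the roles of ν(B), m(λB) and the fractional average at one radius. The two
bounds on mj say mj ≤ m₀ min(1,a) with a = Tn/m₀, and T is tuned so that A₁ m₀^{q/p}/n = t^q/a. -/
theorem le_mul_rpow_mul_min_rpow {p q t A₁ m₀ n mj φ T : ℝ} (hp : 0 < p) (hq : 0 < q) (ht : 0 < t)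
    (hA : 0 < A₁) (hm₀ : 0 < m₀) (hn : 0 < n) (hmj : 0 ≤ mj) (hφ : 0 ≤ φ)
    (hT : T = t ^ q / A₁ * m₀ ^ (1 - q / p)) (hbal : n * φ ^ q ≤ A₁ * mj ^ (q / p))
    (h₁ : mj ≤ m₀) (h₂ : mj ≤ T * n) :
    φ ≤ t * ((T * n / m₀) ^ (-(1 / q)) * min 1 (T * n / m₀) ^ (1 / p)) := by
  have hTpos : 0 < T := by rw [hT]; positivity
  set a := T * n / m₀ with ha
  have hapos : 0 < a := by positivity
  have hmin : mj ≤ m₀ * min 1 a := by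
    rcases min_cases (1 : ℝ) a with ⟨h, -⟩ | ⟨h, -⟩
    · rw [h]; linarith
    · rw [h, ha, mul_div_cancel₀ _ hm₀.ne']; exact h₂
  have hmn : 0 < min 1 a := lt_min one_pos hapos
  rw [← Real.rpow_le_rpow_iff hφ (by positivity) hq]
  have e : (t * (a ^ (-(1 / q)) * min 1 a ^ (1 / p))) ^ q = t ^ q * (a⁻¹ * min 1 a ^ (q / p)) := by
    rw [Real.mul_rpow ht.le (by positivity), Real.mul_rpow (by positivity) (by positivity),
      ← Real.rpow_mul hapos.le, ← Real.rpow_mul hmn.le, show -(1 / q) * q = -1 by field_simp,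
      Real.rpow_neg_one, one_div_mul_eq_div]
  rw [e]
  have hm : m₀ ^ (1 - q / p) * m₀ ^ (q / p) = m₀ := by
    rw [← Real.rpow_add hm₀]; simp
  have key : n * (t ^ q * (a⁻¹ * min 1 a ^ (q / p))) = A₁ * (m₀ ^ (q / p) * min 1 a ^ (q / p)) := by
    have hna : n * a⁻¹ = m₀ / T := by rw [ha]; field_simp
    have hmT : t ^ q * (m₀ / T) = A₁ * m₀ ^ (q / p) := by
      rw [hT, mul_div_assoc', div_eq_iff (by positivity)]
      calc t ^ q * m₀ = t ^ q * (m₀ ^ (1 - q / p) * m₀ ^ (q / p)) := by rw [hm]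
        _ = _ := by field_simp
    calc n * (t ^ q * (a⁻¹ * min 1 a ^ (q / p)))
        = t ^ q * (n * a⁻¹) * min 1 a ^ (q / p) := by ring
      _ = _ := by rw [hna, hmT]; ring
  refine le_of_mul_le_mul_left ?_ hn
  rw [key, ← Real.mul_rpow hm₀.le hmn.le]
  exact hbal.trans (by gcongr)

variable {X : Type*} [MeasurableSpace X] [MetricSpace X]

/-- `ν(B(x, r')) / ν(B(x, r)) ≤ C (r'/r)^δ`, in multiplicative form along dyadic radii. -/
theorem RatioBoundOn.exists_dyadic {ν : Measure X} {E : Set X} {r₀ : ℝ} (h : RatioBoundOn ν E r₀) :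
    ∃ C θ : ℝ, 0 < C ∧ 0 < θ ∧ θ < 1 ∧ ∀ x ∈ E, ∀ ρ : ℝ, 0 < ρ → ρ ≤ r₀ →
      (∀ r, 0 < r → r ≤ ρ → ν (ball x r) ≠ 0 ∧ ν (ball x r) ≠ ∞) → ∀ j k : ℕ,
        ν.real (ball x (ρ / 2 ^ (j + k))) ≤ C * θ ^ k * ν.real (ball x (ρ / 2 ^ j)) := by
  obtain ⟨C, δ, hC, hδ, h⟩ := h
  -- The ratio bound needs r' < r strictly, so k = 0 is separate and requires a constant at least 1.
  refine ⟨C + 1, (1 / 2) ^ δ, by linarith, by positivity,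
    Real.rpow_lt_one (by norm_num) (by norm_num) hδ, fun x hx ρ hρ hρ' hν j k => ?_⟩
  have hr : ∀ j : ℕ, 0 < ρ / 2 ^ j := fun j => by positivity
  have hr' : ∀ j : ℕ, ρ / 2 ^ j ≤ ρ := fun j => div_le_self hρ.le (one_le_pow₀ one_le_two)
  have hpos : 0 < ν.real (ball x (ρ / 2 ^ j)) :=
    ENNReal.toReal_pos (hν _ (hr j) (hr' j)).1 (hν _ (hr j) (hr' j)).2
  rcases Nat.eq_zero_or_pos k with rfl | hk
  · simp only [add_zero, pow_zero, mul_one]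
    nlinarith
  · have hlt : ρ / 2 ^ (j + k) < ρ / 2 ^ j := by
      gcongr
      · norm_num
      · omega
    have h1 := h x hx _ _ (hr (j + k)) hlt ((hr' j).trans hρ')
    have e : ρ / 2 ^ (j + k) / (ρ / 2 ^ j) = (1 / 2) ^ k := by
      rw [pow_add, one_div_pow]; field_simp
    have e2 : ((1 / 2 : ℝ) ^ k) ^ δ = ((1 / 2 : ℝ) ^ δ) ^ k := by
      rw [← Real.rpow_natCast, ← Real.rpow_mul (by norm_num), ← Real.rpow_natCast,
        ← Real.rpow_mul (by norm_num), mul_comm]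
    rw [e, e2, div_le_iff₀ hpos] at h1
    refine h1.trans ?_
    gcongr
    linarith

variable [OpensMeasurableSpace X]

/-- Weak type estimate at the critical exponent for the sum of the fractional averages. -/
theorem MassBalanceOn.exists_measure_lt_tsum_fracAvg_le {μ ν : Measure X}
    {E : Set X} {α p q β ρ r₀ lam : ℝ} {A D : ℝ≥0}
    (h : MassBalanceOn μ ν E p q β ρ A) (hν : EnlargementBoundOn ν E (6 * lam) ρ D)
    (hR : RatioBoundOn ν E r₀) (hlam : 1 ≤ lam) (hρ : 0 < ρ) (hρ' : ρ ≤ r₀) (hp : 0 < p)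
    (hq : p < q) (hβ : α * q + β = 0) :
    ∃ C : ℝ≥0, ∀ m : Measure X, m univ ≠ ∞ → ∀ t : ℝ≥0, t ≠ 0 →
      ν ({x | (t : ℝ≥0∞) < ∑' j : ℕ, fracAvg μ m α p lam (ρ / 2 ^ j) x} ∩ E) ≤
        C * ((t : ℝ≥0∞) ^ q)⁻¹ * m univ ^ (q / p) := by
  have hq0 : 0 < q := hp.trans hq
  obtain ⟨C₁, θ, hC₁, hθ, hθ1, hdy⟩ := hR.exists_dyadic
  obtain ⟨B₀, hB₀⟩ := exists_tsum_min_rpow_le (b := 1 / q) (c := 1 / p) (by positivity)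
    (one_div_lt_one_div_of_lt hp hq) hC₁ hθ hθ1
  -- The level t is later replaced by t/B, so that the summation bound B₀ brings the total back
  -- below t. The added 1, as in `A₁`, ensures positivity.
  set B : ℝ≥0 := B₀ + 1 with hB
  have hBpos : 0 < B := by positivity
  set A₁ : ℝ≥0 := A + 1 with hA₁
  have hA₁pos : 0 < A₁ := by positivity
  refine ⟨D * (A₁ * B ^ q), fun m hm t ht => ?_⟩
  have hfin : IsFiniteMeasure m := ⟨hm.lt_top⟩
  have htpos : 0 < t := pos_iff_ne_zero.2 ht
  by_cases hm0 : m univ = 0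
  · have : {x | (t : ℝ≥0∞) < ∑' j : ℕ, fracAvg μ m α p lam (ρ / 2 ^ j) x} ∩ E = ∅ := by
      rw [eq_empty_iff_forall_notMem]
      rintro x ⟨hx, -⟩
      have h0 : ∀ S : Set X, m S = 0 := fun S => measure_mono_null (subset_univ S) hm0
      have hz : ∀ j : ℕ, fracAvg μ m α p lam (ρ / 2 ^ j) x = 0 := by
        intro j
        rw [fracAvg, h0, mul_zero, ENNReal.zero_rpow_of_pos (by positivity), mul_zero]
      simp only [mem_ofPred_eq, hz, tsum_zero] at hx
      exact not_lt_bot hx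
    rw [this, measure_empty]
    exact zero_le
  set m₀ : ℝ≥0 := (m univ).toNNReal with hm₀
  have hm₀e : (m₀ : ℝ≥0∞) = m univ := ENNReal.coe_toNNReal hm
  have hm₀pos : 0 < m₀ := ENNReal.toNNReal_pos hm0 hm
  -- With this threshold T⁻¹ m(X) is precisely the desired multiple of t^{-q} m(X)^{q/p}.
  set T : ℝ≥0 := (t / B) ^ q / A₁ * m₀ ^ (1 - q / p) with hT
  have hTpos : 0 < T := by
    have : 0 < t / B := by positivity
    have h1 : 0 < (t / B) ^ q := NNReal.rpow_pos this
    have h2 : 0 < m₀ ^ (1 - q / p) := NNReal.rpow_pos hm₀pos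
    positivity
  have hTe : (T : ℝ≥0∞)⁻¹ * m univ ^ (1 : ℝ) = A₁ * B ^ q * ((t : ℝ≥0∞) ^ q)⁻¹ * m univ ^ (q / p) := by
    rw [← hm₀e, ENNReal.rpow_one, ← ENNReal.coe_rpow_of_nonneg _ hq0.le,
      ← ENNReal.coe_rpow_of_nonneg _ (by positivity : 0 ≤ q / p),
      ← ENNReal.coe_rpow_of_nonneg _ hq0.le,
      ← ENNReal.coe_inv hTpos.ne', ← ENNReal.coe_inv (NNReal.rpow_pos htpos).ne']
    norm_cast
    have h1 : m₀ ^ (1 - q / p) * m₀ ^ (q / p) = m₀ := by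
      rw [← NNReal.rpow_add hm₀pos.ne']; simp
    have h2 := NNReal.rpow_pos (p := q) htpos
    have h3 := NNReal.rpow_pos (p := q) hBpos
    have h4 := NNReal.rpow_pos (p := 1 - q / p) hm₀pos
    rw [hT, NNReal.div_rpow, inv_mul_eq_iff_eq_mul₀ (by positivity)]
    calc m₀ = m₀ ^ (1 - q / p) * m₀ ^ (q / p) := h1.symm
      _ = _ := by field_simp
  refine (hν.measure_le_of_ball_le hlam inter_subset_right le_rfl (κ := 1) (W := (T : ℝ≥0∞)⁻¹)
    (m := m) ?_).trans (le_of_eq ?_)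
  swap
  · rw [hTe]
    push_cast
    rw [ENNReal.coe_rpow_of_nonneg _ hq0.le]
    ring
  rintro x ⟨hxt, hxE⟩
  -- If no ball has ν(B) ≤ T⁻¹ m(λB), then m(λB) ≤ T ν(B) at every dyadic scale, and the summation
  -- lemma forces the sum to be at most t.
  by_contra! hcon
  have hr : ∀ j : ℕ, 0 < ρ / 2 ^ j := fun j => by positivity
  have hr' : ∀ j : ℕ, ρ / 2 ^ j ≤ ρ := fun j => div_le_self hρ.le (one_le_pow₀ one_le_two)
  have hνb : ∀ r, 0 < r → r ≤ ρ → ν (ball x r) ≠ 0 ∧ ν (ball x r) ≠ ∞ := fun r h1 h2 =>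
    ⟨(hν x hxE r h1 h2).1, hν.measure_ball_ne_top (by linarith) hxE h1 h2⟩
  set n : ℕ → ℝ := fun j => ν.real (ball x (ρ / 2 ^ j)) with hn
  have hnpos : ∀ j, 0 < n j := fun j =>
    ENNReal.toReal_pos (hνb _ (hr j) (hr' j)).1 (hνb _ (hr j) (hr' j)).2
  have hne : ∀ j, ν (ball x (ρ / 2 ^ j)) = ENNReal.ofReal (n j) := fun j =>
    (ENNReal.ofReal_toReal (hνb _ (hr j) (hr' j)).2).symm
  set a : ℕ → ℝ := fun j => T * n j / m₀ with ha
  have hapos : ∀ j, 0 < a j := fun j => by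
    have := hnpos j
    have h1 : (0 : ℝ) < T := hTpos
    have h2 : (0 : ℝ) < m₀ := hm₀pos
    positivity
  have hak : ∀ j k, a (j + k) ≤ C₁ * θ ^ k * a j := by
    intro j k
    have h1 := hdy x hxE ρ hρ hρ' hνb j k
    calc a (j + k) ≤ T * (C₁ * θ ^ k * n j) / m₀ := by
          simp only [ha]
          gcongr
      _ = _ := by simp only [ha]; ring
  have hΦ : ∀ j, fracAvg μ m α p lam (ρ / 2 ^ j) x ≤
      ENNReal.ofReal (t / B) * ENNReal.ofReal (a j ^ (-(1 / q)) * min 1 (a j) ^ (1 / p)) := by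
    intro j
    have hk := h.mul_fracAvg_rpow_le hp hq0 m α lam hxE (hr j) (hr' j)
    rw [hβ, Real.rpow_zero, ENNReal.ofReal_one, mul_one] at hk
    set φ := fracAvg μ m α p lam (ρ / 2 ^ j) x with hφ
    set mj := m (ball x (lam * (ρ / 2 ^ j))) with hmj
    have hmjtop : mj ≠ ∞ := MeasureTheory.measure_ne_top m _
    have hφtop : φ ≠ ∞ := by
      intro htop
      rw [htop, ENNReal.top_rpow_of_pos hq0, ENNReal.mul_top (hνb _ (hr j) (hr' j)).1] at hk
      exact (ENNReal.mul_lt_top ENNReal.coe_lt_top (ENNReal.rpow_lt_top_of_nonneg (by positivity)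
        hmjtop)).not_ge hk
    have hbal : n j * φ.toReal ^ q ≤ A₁ * mj.toReal ^ (q / p) := by
      have h1 := ENNReal.toReal_mono (ENNReal.mul_ne_top ENNReal.coe_ne_top
        (ENNReal.rpow_ne_top_of_nonneg (by positivity) hmjtop)) hk
      rw [ENNReal.toReal_mul, ENNReal.toReal_mul, ← ENNReal.toReal_rpow,
        ← ENNReal.toReal_rpow, ENNReal.coe_toReal] at h1
      refine h1.trans ?_
      gcongr
      rw [hA₁]
      simp
    have hT' : (T : ℝ) = (t / B : ℝ) ^ q / A₁ * (m₀ : ℝ) ^ (1 - q / p) := by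
      rw [hT]
      push_cast
      rfl
    have hm1 : mj.toReal ≤ m₀ := ENNReal.toReal_mono hm (measure_mono (subset_univ _))
    have hm2 : mj.toReal ≤ T * n j := by
      have h1 := hcon (ρ / 2 ^ j) (hr j) (hr' j)
      rw [ENNReal.rpow_one] at h1
      have h2 : mj ≤ T * ν (ball x (ρ / 2 ^ j)) := by
        rw [mul_comm, ← ENNReal.div_le_iff (by simpa using hTpos.ne') ENNReal.coe_ne_top,
          ENNReal.div_eq_inv_mul]
        exact h1.le
      have h3 := ENNReal.toReal_mono (ENNReal.mul_ne_top ENNReal.coe_ne_top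
        (hνb _ (hr j) (hr' j)).2) h2
      rwa [ENNReal.toReal_mul, ENNReal.coe_toReal] at h3
    have hfinal := le_mul_rpow_mul_min_rpow hp hq0
      (show (0 : ℝ) < t / B from div_pos (by exact_mod_cast htpos) (by exact_mod_cast hBpos))
      (by exact_mod_cast hA₁pos) (by exact_mod_cast hm₀pos) (hnpos j)
      ENNReal.toReal_nonneg ENNReal.toReal_nonneg hT' hbal hm1 hm2
    rw [← ENNReal.ofReal_mul (by positivity), ← ENNReal.ofReal_toReal hφtop]
    exact ENNReal.ofReal_le_ofReal hfinal
  have hsum : ∑' j : ℕ, fracAvg μ m α p lam (ρ / 2 ^ j) x ≤ t := by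
    calc _ ≤ ∑' j, ENNReal.ofReal (t / B) *
          ENNReal.ofReal (a j ^ (-(1 / q)) * min 1 (a j) ^ (1 / p)) := ENNReal.tsum_le_tsum hΦ
      _ = ENNReal.ofReal (t / B) *
          ∑' j, ENNReal.ofReal (a j ^ (-(1 / q)) * min 1 (a j) ^ (1 / p)) := ENNReal.tsum_mul_left
      _ ≤ ENNReal.ofReal (t / B) * B := by
          gcongr
          refine (hB₀ a hapos hak).trans ?_
          exact_mod_cast le_self_add
      _ = t := by
          rw [← ENNReal.ofReal_coe_nnreal (p := B), ← ENNReal.ofReal_mul (by positivity),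
            div_mul_cancel₀ _ (by exact_mod_cast hBpos.ne'), ENNReal.ofReal_coe_nnreal]
  exact absurd hxt (not_lt.2 hsum)

end Hedberg

section Truncation

variable {X : Type*} [MeasurableSpace X]

/-! ### Truncations -/

/-- Superadditivity of the lower integral suffices for this direction, so no measurability of the
level sets of u is needed later. -/
theorem tsum_lintegral_le_lintegral_tsum {μ : Measure X} (f : ℕ → X → ℝ≥0∞) :
    ∑' k, ∫⁻ x, f k x ∂μ ≤ ∫⁻ x, ∑' k, f k x ∂μ := by
  refine ENNReal.tsum_le_of_sum_range_le fun n => ?_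
  have : ∀ n : ℕ, ∑ k ∈ Finset.range n, ∫⁻ x, f k x ∂μ ≤
      ∫⁻ x, ∑ k ∈ Finset.range n, f k x ∂μ := by
    intro n
    induction n with
    | zero => simp
    | succ n ih =>
      simp only [Finset.sum_range_succ]
      exact (add_le_add_left ih _).trans (le_lintegral_add _ _)
  exact (this n).trans (lintegral_mono fun x => ENNReal.sum_le_tsum _)

theorem tsum_gradMeasure_indicator_le {μ : Measure X} {p : ℝ} (hp : 0 < p) (g : X → ℝ)
    {S : ℕ → Set X} (hS : Pairwise (Function.onFun Disjoint S)) :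
    ∑' k, gradMeasure μ p ((S k).indicator g) univ ≤ gradMeasure μ p g univ := by
  simp only [gradMeasure, withDensity_apply _ MeasurableSet.univ, setLIntegral_univ]
  refine (tsum_lintegral_le_lintegral_tsum _).trans (lintegral_mono fun x => ?_)
  by_cases hx : ∃ k, x ∈ S k
  · obtain ⟨k, hk⟩ := hx
    rw [tsum_eq_single k]
    · simp [hk]
    · intro j hj
      have : x ∉ S j := fun h => (Set.disjoint_left.1 (hS hj) h hk)
      simp [this, hp]
  · push Not at hx
    simp [hx, hp]

/-- The inclusion of ℓ¹ in ℓ^κ; it allows the truncation estimates to be summed with exponent κ =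
q/p. -/
theorem tsum_rpow_le {a : ℕ → ℝ≥0∞} {κ : ℝ} (hκ : 1 ≤ κ) {b : ℝ≥0∞} (h : ∑' k, a k ≤ b) :
    ∑' k, a k ^ κ ≤ b ^ κ := by
  have hsplit : ∀ c : ℝ≥0∞, c ^ κ = c ^ (κ - 1) * c := by
    intro c
    conv_lhs => rw [show κ = (κ - 1) + 1 by ring]
    rw [ENNReal.rpow_add_of_nonneg _ _ (by linarith) zero_le_one, ENNReal.rpow_one]
  calc ∑' k, a k ^ κ ≤ ∑' k, b ^ (κ - 1) * a k := by
        refine ENNReal.tsum_le_tsum fun k => ?_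
        rw [hsplit]
        gcongr
        exact (ENNReal.le_tsum k).trans h
    _ = b ^ (κ - 1) * ∑' k, a k := ENNReal.tsum_mul_left
    _ ≤ b ^ κ := by rw [hsplit b]; gcongr

variable [MetricSpace X]

/-- The Poincaré inequality holds for all truncations of `u`. -/
def TruncatedPoincareOn (μ : Measure X) (E : Set X) (α p lam ρ K : ℝ) (u g : X → ℝ) : Prop :=
  ∀ l k : ℝ, l < k → PoincareIneqOn μ E α p lam ρ K (fun x => max l (min (u x) k))
    ({x | l < u x ∧ u x < k}.indicator g)

/-- Truncating −u between l and k is minus the truncation of u between −k and −l. This lets the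
estimate for large positive values also handle the negative ones. -/
theorem TruncatedPoincareOn.neg {μ : Measure X} {E : Set X} {α p lam ρ K : ℝ} {u g : X → ℝ}
    (h : TruncatedPoincareOn μ E α p lam ρ K u g) :
    TruncatedPoincareOn μ E α p lam ρ K (-u) g := by
  intro l k hlk x hx r hr hr'
  have h1 := h (-k) (-l) (neg_lt_neg hlk) x hx r hr hr'
  have e1 : ∀ y, max l (min ((-u) y) k) = -max (-k) (min (u y) (-l)) := by
    intro y
    have : max (-k) (min (u y) (-l)) = min (max (-k) (u y)) (-l) := by
      rw [max_min_distrib_left, max_eq_right (neg_le_neg hlk.le)]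
    rw [this, ← max_neg_neg, neg_neg, ← min_neg_neg, neg_neg, Pi.neg_apply, max_comm, min_comm]
  have e2 : {y | l < (-u) y ∧ (-u) y < k} = {y | -k < u y ∧ u y < -l} := by
    ext y
    simp only [Pi.neg_apply, mem_ofPred_eq]
    constructor <;> rintro ⟨h1, h2⟩ <;> constructor <;> linarith
  rw [e2]
  refine le_trans (le_of_eq ?_) h1
  simp only [e1]
  have : (⨍ z in ball x r, -max (-k) (min (u z) (-l)) ∂μ) =
      -⨍ z in ball x r, max (-k) (min (u z) (-l)) ∂μ := by
    rw [setAverage_eq, setAverage_eq, integral_neg, smul_neg]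
  rw [this]
  simp only [neg_sub_neg, abs_sub_comm]

omit [MetricSpace X] in
theorem integrableOn_truncation {μ : Measure X} {u : X → ℝ} {S : Set X} (l k : ℝ)
    (hu : IntegrableOn u S μ) (hS : μ S ≠ ∞) :
    IntegrableOn (fun x => max l (min (u x) k)) S μ := by
  have : IsFiniteMeasure (μ.restrict S) := ⟨by simpa using hS.lt_top⟩
  exact (integrable_const l).sup (hu.inf (integrable_const k))

theorem abs_truncation_sub_le {l k : ℝ} (hl : 0 ≤ l) (a : ℝ) :
    |max l (min a k) - l| ≤ |a| := by
  rw [abs_of_nonneg (sub_nonneg.2 (le_max_left _ _)), sub_le_iff_le_add]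
  refine max_le (by linarith [abs_nonneg a]) ((min_le_left _ _).trans ?_)
  linarith [le_abs_self a]

theorem abs_truncation_sub_truncation_le (l k a b : ℝ) :
    |max l (min a k) - max l (min b k)| ≤ |a - b| := by
  refine (abs_max_sub_max_le_max _ _ _ _).trans ?_
  rw [sub_self, abs_zero, max_eq_right (abs_nonneg _)]
  refine (abs_min_sub_min_le_max _ _ _ _).trans ?_
  rw [sub_self, abs_zero, max_eq_left (abs_nonneg _)]

variable [OpensMeasurableSpace X]

/-- At a point where the Lebesgue value of `u` exceeds `2l`, the fractional averages of the
gradient of the truncation between `l` and `2l` are large. -/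
theorem TruncatedPoincareOn.lt_tsum_fracAvg {μ : Measure X} {E : Set X} {α p lam ρ : ℝ}
    {K : ℝ} {D : ℝ≥0} {u g : X → ℝ} (h : TruncatedPoincareOn μ E α p lam ρ K u g)
    (hμ : EnlargementBoundOn μ E 4 ρ D) (hρ : 0 < ρ) (hp : 1 ≤ p) (hlam : 1 ≤ lam)
    (hu : ∀ x r, IntegrableOn u (ball x r) μ) {x : X} (hx : x ∈ E) {L : ℝ}
    (hL : IsLebesgueValue μ u x L) {l : ℝ≥0} (hl : 0 < l)
    (hmean : ⨍ y in ball x ρ, |u y| ∂μ ≤ l / 2) (hLl : 2 * l < L) :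
    ((l / (4 * (D * ‖K‖₊ + 1)) : ℝ≥0) : ℝ≥0∞) < ∑' j : ℕ, fracAvg μ
      (gradMeasure μ p ({y | (l : ℝ) < u y ∧ u y < 2 * l}.indicator g)) α p lam (ρ / 2 ^ j) x := by
  set m := gradMeasure μ p ({y | (l : ℝ) < u y ∧ u y < 2 * l}.indicator g) with hm
  have hl0 : (0 : ℝ) < l := hl
  have hb := hμ.measure_ball hx
  by_cases hS : ∑' j : ℕ, fracAvg μ m α p lam (ρ / 2 ^ j) x = ∞
  · rw [hS]; exact ENNReal.coe_lt_top
  set w : X → ℝ := fun y => max (l : ℝ) (min (u y) (2 * l)) with hw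
  have hwi : ∀ r ≤ ρ, IntegrableOn w (ball x r) μ := by
    intro r hr
    rcases le_or_gt r 0 with h0 | h0
    · rw [ball_eq_empty.2 h0]; exact integrableOn_empty
    · exact integrableOn_truncation _ _ (hu x r) (hb r h0 hr).2
  obtain ⟨L', hL', hLn⟩ := exists_isLebesgueValue hμ hρ hx hwi
    (Φ := fun r => fracAvg μ m α p lam r x) (K := ‖K‖₊)
    (fun r hr hr' => (h l (2 * l) (by linarith)).ofReal_le hp hlam hx hr hr') hS
  -- Since L > 2l, the truncation maps L to its upper level.
  have hval : IsLebesgueValue μ w x (2 * l) := by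
    have := hL.comp_lipschitz (T := fun a => max (l : ℝ) (min a (2 * l))) (fun r _ => hu x r) hρ hb
      (abs_truncation_sub_truncation_le _ _)
    rwa [min_eq_right hLl.le, max_eq_right (by linarith)] at this
  have hLeq : L' = 2 * l :=
    tendsto_nhds_unique (hL'.tendsto_setAverage hwi hρ hb) (hval.tendsto_setAverage hwi hρ hb)
  have h0 := hLn 0
  simp only [pow_zero, div_one, zero_add] at h0
  have hbρ := hb ρ hρ le_rfl
  -- As 0 ≤ w − l ≤ |u|, the mean bound keeps the average of w below 3l/2; telescoping must then
  -- bridge a gap of at least l/2.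
  have h1 : |(⨍ y in ball x ρ, w y ∂μ) - l| ≤ l / 2 := by
    refine (abs_setAverage_sub_le _ (hwi ρ le_rfl) hbρ.1 hbρ.2).trans (le_trans ?_ hmean)
    rw [setAverage_eq, setAverage_eq, smul_eq_mul, smul_eq_mul]
    refine mul_le_mul_of_nonneg_left ?_ (inv_nonneg.2 measureReal_nonneg)
    exact integral_mono (integrableOn_abs_sub_const _ (hwi ρ le_rfl) hbρ.2) (hu x ρ).abs
      fun y => abs_truncation_sub_le hl0.le _
  have h2 : (l : ℝ) / 2 ≤ |L' - ⨍ y in ball x ρ, w y ∂μ| := by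
    rw [hLeq]
    refine le_trans ?_ (le_abs_self _)
    linarith [(abs_le.1 h1).2]
  have h3 : ((l / 2 : ℝ≥0) : ℝ≥0∞) ≤
      (D * ‖K‖₊ + 1 : ℝ≥0) * ∑' j : ℕ, fracAvg μ m α p lam (ρ / 2 ^ j) x := by
    calc ((l / 2 : ℝ≥0) : ℝ≥0∞) = ENNReal.ofReal ((l : ℝ) / 2) := by
          rw [← ENNReal.ofReal_coe_nnreal]; simp
      _ ≤ _ := (ENNReal.ofReal_le_ofReal h2).trans h0
      _ ≤ _ := by
          gcongr
          push_cast
          exact le_self_add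
  lift (∑' j : ℕ, fracAvg μ m α p lam (ρ / 2 ^ j) x) to ℝ≥0 using hS with s
  rw [← ENNReal.coe_mul, ENNReal.coe_le_coe] at h3
  rw [ENNReal.coe_lt_coe, div_lt_iff₀ (by positivity)]
  have h4 : (l : ℝ) / 2 ≤ (D * ‖K‖₊ + 1) * s := by exact_mod_cast h3
  have h5 : (l : ℝ) < s * (4 * (D * ‖K‖₊ + 1)) := by nlinarith
  exact_mod_cast h5

end Truncation

section Critical

/-! ### The critical exponent -/

theorem disjoint_dyadic_levels {X : Type*} (u : X → ℝ) {a : ℝ} (ha : 0 < a) :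
    Pairwise (Function.onFun Disjoint
      fun k : ℕ => {y | a * 2 ^ k < u y ∧ u y < 2 * (a * 2 ^ k)}) := by
  have key : ∀ i j : ℕ, i < j → Disjoint {y | a * 2 ^ i < u y ∧ u y < 2 * (a * 2 ^ i)}
      {y | a * 2 ^ j < u y ∧ u y < 2 * (a * 2 ^ j)} := by
    intro i j hij
    refine Set.disjoint_left.2 fun y hi hj => ?_
    have h1 : a * 2 ^ (i + 1) ≤ a * 2 ^ j := by
      gcongr
      · norm_num
      · omega
    have h2 := hi.2
    have h3 := hj.1
    rw [pow_succ] at h1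
    linarith
  intro i j hij
  rcases lt_or_gt_of_ne hij with h | h
  · exact key i j h
  · exact (key j i h).symm

variable {X : Type*} [MeasurableSpace X] [MetricSpace X] [OpensMeasurableSpace X]

namespace SubcriticalSetting

variable {μ ν : Measure X} {E : Set X} {p α lam ρ q₁ β ε : ℝ} {D A : ℝ≥0}
  {Y : Set (X → ℝ)} {G : (X → ℝ) → (X → ℝ)} {N : (X → ℝ) → ℝ≥0∞}

/-- Maz'ya's truncation: where v exceeds twice the level l = a2^k, the gradient of the truncation
between l and 2l has a large sum of fractional averages. The weak type bound controls that set by a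
multiple of l^{-q} m_k(X)^{q/p}; the weight cancels l^{-q}, and disjointness of the level sets gives
Σ m_k(X) ≤ τ^p. -/
theorem exists_tsum_measure_lt_le (S : SubcriticalSetting μ ν E p α lam ρ q₁ β ε D A)
    {q β' r₀ ρ' : ℝ} {A' : ℝ≥0} (hbal : MassBalanceOn μ ν E p q β' ρ A')
    (hβ' : α * q + β' = 0) (hR : RatioBoundOn ν E r₀) (hρr : ρ ≤ r₀) (hρ' : 0 < ρ')
    (hρρ : ρ' ≤ ρ) (hq : p < q) (K : ℝ) :
    ∃ C : ℝ≥0, ∀ (u v g : X → ℝ), (∀ x r, IntegrableOn u (ball x r) μ) →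
      TruncatedPoincareOn μ E α p lam ρ' K u g →
      ∀ τ : ℝ≥0, gradMeasure μ p g univ ≤ (τ : ℝ≥0∞) ^ p → ∀ a : ℝ≥0, 0 < a →
      (∀ᵐ x ∂(ν.restrict E), IsLebesgueValue μ u x (v x) ∧ ⨍ y in ball x ρ', |u y| ∂μ ≤ a / 2) →
      ∑' k : ℕ, (((2 * a : ℝ≥0) : ℝ≥0∞) * 2 ^ (k + 1)) ^ q *
        (ν.restrict E) {x | 2 * ((a : ℝ) * 2 ^ k) < v x} ≤ C * (τ : ℝ≥0∞) ^ q := by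
  have hp := S.p_pos
  have hq0 : 0 < q := hp.trans hq
  obtain ⟨C, hC⟩ := MassBalanceOn.exists_measure_lt_tsum_fracAvg_le (ρ := ρ')
    (fun x hx r hr hr' => hbal x hx r hr (hr'.trans hρρ)) (S.enlarge.mono hρρ) hR S.one_le_lam hρ'
    (hρρ.trans hρr) hp hq hβ'
  set c : ℝ≥0 := 4 * (D * ‖K‖₊ + 1) with hc
  have hcpos : 0 < c := by positivity
  refine ⟨(4 * c) ^ q * C, fun u v g hu hT τ hm a ha hae => ?_⟩
  have hmtop : ∀ g' : X → ℝ, gradMeasure μ p g' univ ≤ gradMeasure μ p g univ →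
      gradMeasure μ p g' univ ≠ ∞ := fun g' h =>
    ne_top_of_le_ne_top (ENNReal.rpow_ne_top_of_nonneg hp.le ENNReal.coe_ne_top) (h.trans hm)
  set m : ℕ → Measure X := fun k => gradMeasure μ p
    ({y | (a : ℝ) * 2 ^ k < u y ∧ u y < 2 * ((a : ℝ) * 2 ^ k)}.indicator g) with hmk
  have hsum : ∑' k, m k univ ≤ (τ : ℝ≥0∞) ^ p :=
    (tsum_gradMeasure_indicator_le hp g (disjoint_dyadic_levels u (by exact_mod_cast ha))).trans hm
  have hsum' : ∑' k, (m k univ) ^ (q / p) ≤ (τ : ℝ≥0∞) ^ q := by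
    refine (tsum_rpow_le ((one_le_div hp).2 hq.le) hsum).trans (le_of_eq ?_)
    rw [← ENNReal.rpow_mul, mul_div_cancel₀ _ hp.ne']
  have hterm : ∀ k : ℕ, (((2 * a : ℝ≥0) : ℝ≥0∞) * 2 ^ (k + 1)) ^ q *
      (ν.restrict E) {x | 2 * ((a : ℝ) * 2 ^ k) < v x} ≤
      ((4 * c) ^ q * C : ℝ≥0) * (m k univ) ^ (q / p) := by
    intro k
    set l : ℝ≥0 := a * 2 ^ k with hl
    have hlpos : 0 < l := by positivity
    have hlr : (l : ℝ) = (a : ℝ) * 2 ^ k := by rw [hl]; push_cast; rfl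
    have hal : (a : ℝ) ≤ l := by
      rw [hlr]
      exact le_mul_of_one_le_right a.coe_nonneg (one_le_pow₀ one_le_two)
    have hmktop : m k univ ≠ ∞ := ne_top_of_le_ne_top
      (ENNReal.rpow_ne_top_of_nonneg hp.le ENNReal.coe_ne_top) ((ENNReal.le_tsum k).trans hsum)
    have hlc : l / c ≠ 0 := by positivity
    have h1 : (ν.restrict E) {x | 2 * ((a : ℝ) * 2 ^ k) < v x} ≤
        (ν.restrict E) {x | ((l / c : ℝ≥0) : ℝ≥0∞) <
          ∑' j : ℕ, fracAvg μ (m k) α p lam (ρ' / 2 ^ j) x} := by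
      refine measure_mono_ae ?_
      filter_upwards [hae, S.ae_mem] with x hx hxE hv
      have hv' : 2 * (l : ℝ) < v x := by rw [hlr]; exact hv
      have := hT.lt_tsum_fracAvg (S.doubling.mono hρρ) hρ' S.one_le_p S.one_le_lam hu hxE hx.1
        hlpos (hx.2.trans (by linarith)) hv'
      rw [hlr] at this
      exact this
    rw [Measure.restrict_apply₀' S.nullMeasurableSet (s := E) (t := {x | ((l / c : ℝ≥0) : ℝ≥0∞) <
          ∑' j : ℕ, fracAvg μ (m k) α p lam (ρ' / 2 ^ j) x})] at h1
    have h2 := h1.trans (hC (m k) hmktop (l / c) hlc)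
    have e1 : (((2 * a : ℝ≥0) : ℝ≥0∞) * 2 ^ (k + 1)) = ((4 * l : ℝ≥0) : ℝ≥0∞) := by
      rw [hl]; push_cast; ring
    have e2 : (((4 * l : ℝ≥0) : ℝ≥0∞)) ^ q * (((l / c : ℝ≥0) : ℝ≥0∞) ^ q)⁻¹ =
        (((4 * c) ^ q : ℝ≥0) : ℝ≥0∞) := by
      rw [← ENNReal.coe_rpow_of_nonneg _ hq0.le, ← ENNReal.coe_rpow_of_nonneg _ hq0.le,
        ← ENNReal.coe_inv (NNReal.rpow_pos (pos_iff_ne_zero.2 hlc)).ne', ← ENNReal.coe_mul,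
        ← div_eq_mul_inv, ← NNReal.div_rpow]
      congr 2
      field_simp
    calc _ ≤ (((4 * l : ℝ≥0) : ℝ≥0∞)) ^ q *
          (C * (((l / c : ℝ≥0) : ℝ≥0∞) ^ q)⁻¹ * m k univ ^ (q / p)) := by rw [e1]; gcongr
      _ = ((((4 * l : ℝ≥0) : ℝ≥0∞)) ^ q * (((l / c : ℝ≥0) : ℝ≥0∞) ^ q)⁻¹) * C *
          m k univ ^ (q / p) := by ring
      _ = _ := by rw [e2, ENNReal.coe_mul]
  calc _ ≤ ∑' k, ((4 * c) ^ q * C : ℝ≥0) * (m k univ) ^ (q / p) := ENNReal.tsum_le_tsum hterm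
    _ = ((4 * c) ^ q * C : ℝ≥0) * ∑' k, (m k univ) ^ (q / p) := ENNReal.tsum_mul_left
    _ ≤ _ := by gcongr

theorem exists_eLpNorm_preciseRep_le_of_critical
    (S : SubcriticalSetting μ ν E p α lam ρ q₁ β ε D A) {K₀ : ℝ≥0}
    (hY : ∀ u ∈ Y, OscillationBoundOn μ E p α lam ρ K₀ u (gradMeasure μ p (G u)))
    (hNG : ∀ u, eLpNorm (G u) (ENNReal.ofReal p) μ ≤ N u)
    {q β' r₀ ρ' : ℝ} {A' : ℝ≥0} (hbal : MassBalanceOn μ ν E p q β' ρ A')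
    (hβ' : α * q + β' = 0) (hR : RatioBoundOn ν E r₀) (hρr : ρ ≤ r₀) (hρ' : 0 < ρ')
    (hρρ : ρ' ≤ ρ) (hq : p < q) {K : ℝ}
    (hT : ∀ u ∈ Y, TruncatedPoincareOn μ E α p lam ρ' K u (G u)) {C₀ : ℝ≥0}
    (hmean : MeanBoundOn μ ν E Y N ρ' C₀) :
    ∃ C : ℝ≥0, ∀ u ∈ Y, ∀ τ : ℝ≥0, τ ≠ 0 → N u ≤ τ →
      eLpNorm (preciseRep μ u) (ENNReal.ofReal q) (ν.restrict E) ≤ C * τ := by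
  have hp := S.p_pos
  have hq0 : 0 < q := hp.trans hq
  obtain ⟨C₁, hC₁⟩ := S.exists_abs_preciseRep_sub_le K₀
  obtain ⟨C, hC⟩ := S.exists_tsum_measure_lt_le hbal hβ' hR hρr hρ' hρρ hq K
  set B : ℝ≥0 := (4 * (C₀ + 1)) ^ q * (ν E).toNNReal + (C + C) with hB
  refine ⟨B ^ (1 / q), fun u hu τ hτ hN => ?_⟩
  have hτpos : 0 < τ := pos_iff_ne_zero.2 hτ
  have hm := gradMeasure_univ_le S.one_le_p ((hNG u).trans hN)
  have hum := hY u hu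
  set v := preciseRep μ u with hv
  -- Makes C₀τ ≤ a/2, so the mean bound holds at every level above a; the values below 2a are
  -- absorbed by ν(E).
  set a : ℝ≥0 := 2 * (C₀ + 1) * τ with ha
  have hapos : 0 < a := by positivity
  have hae : ∀ᵐ x ∂(ν.restrict E), IsLebesgueValue μ u x (v x) ∧
      ⨍ y in ball x ρ', |u y| ∂μ ≤ a / 2 := by
    filter_upwards [S.ae_mem, S.ae_dyadicMax_ne_top hτ hm, hmean] with x hx hM hxm
    refine ⟨(hC₁ u _ hum x hx hM).1, (hxm u hu τ hτ hN).trans ?_⟩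
    rw [ha]
    push_cast
    nlinarith [τ.coe_nonneg, C₀.coe_nonneg]
  have hae' : ∀ᵐ x ∂(ν.restrict E), IsLebesgueValue μ (-u) x ((-v) x) ∧
      ⨍ y in ball x ρ', |(-u) y| ∂μ ≤ a / 2 := by
    filter_upwards [hae, S.ae_mem] with x hx hxE
    refine ⟨hx.1.comp_lipschitz (T := fun t => -t) (fun r _ => hum.1 x r) S.ρ_pos
      (S.doubling.measure_ball hxE) fun s t => ?_, by simpa using hx.2⟩
    rw [neg_sub_neg, abs_sub_comm]
  have h1 := hC u v (G u) hum.1 (hT u hu) τ hm a hapos hae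
  have h2 := hC (-u) (-v) (G u) (fun x r => (hum.1 x r).neg) (hT u hu).neg τ hm a hapos hae'
  have hmeas : AEMeasurable v (ν.restrict E) := S.aemeasurable_preciseRep hum hτ hm
  have hlc := lintegral_rpow_le_tsum (ν := ν.restrict E) (f := fun x => ‖v x‖ₑ) hmeas.enorm hq0
    (τ := ((2 * a : ℝ≥0) : ℝ≥0∞)) (by simpa using hapos.ne') ENNReal.coe_ne_top
  have hset : ∀ k : ℕ, (ν.restrict E) {x | ((2 * a : ℝ≥0) : ℝ≥0∞) * 2 ^ k < ‖v x‖ₑ} ≤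
      (ν.restrict E) {x | 2 * ((a : ℝ) * 2 ^ k) < v x} +
      (ν.restrict E) {x | 2 * ((a : ℝ) * 2 ^ k) < (-v) x} := by
    intro k
    refine (measure_mono fun x hx => ?_).trans (measure_union_le _ _)
    have hx' : ((2 * a : ℝ≥0) : ℝ≥0∞) * 2 ^ k < ‖v x‖ₑ := hx
    have e : ((2 * a : ℝ≥0) : ℝ≥0∞) * 2 ^ k = ENNReal.ofReal (2 * ((a : ℝ) * 2 ^ k)) := by
      have : (2 * ((a : ℝ) * 2 ^ k)) = ((2 * a * 2 ^ k : ℝ≥0) : ℝ) := by push_cast; ring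
      rw [this, ENNReal.ofReal_coe_nnreal]
      push_cast
      rfl
    rw [e, Real.enorm_eq_ofReal_abs, ENNReal.ofReal_lt_ofReal_iff_of_nonneg (by positivity)] at hx'
    rcases lt_abs.1 hx' with h | h
    · exact Or.inl h
    · exact Or.inr h
  have hfin : ∫⁻ x in E, ‖v x‖ₑ ^ q ∂ν ≤ B * (τ : ℝ≥0∞) ^ q := by
    refine hlc.trans ?_
    rw [hB]
    push_cast
    rw [ENNReal.coe_toNNReal S.measure_ne_top, add_mul, Measure.restrict_apply_univ]
    refine add_le_add (le_of_eq ?_) ?_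
    · have : ((2 : ℝ≥0∞) * a) = (4 * (C₀ + 1) : ℝ≥0) * τ := by
        rw [ha]; push_cast; ring
      rw [this, ENNReal.mul_rpow_of_nonneg _ _ hq0.le, ENNReal.coe_rpow_of_nonneg _ hq0.le]
      ring
    · rw [add_mul]
      refine le_trans ?_ (add_le_add h1 h2)
      rw [← ENNReal.tsum_add]
      refine ENNReal.tsum_le_tsum fun k => ?_
      rw [← mul_add]
      push_cast
      gcongr
      simpa using hset k
  rw [eLpNorm_eq_lintegral_rpow_enorm_toReal (by simpa using hq0) ENNReal.ofReal_ne_top,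
    ENNReal.toReal_ofReal hq0.le]
  calc _ ≤ (B * (τ : ℝ≥0∞) ^ q) ^ (1 / q) := by gcongr
    _ = _ := by
      rw [ENNReal.mul_rpow_of_nonneg _ _ (by positivity), ← ENNReal.rpow_mul,
        mul_one_div_cancel hq0.ne', ENNReal.rpow_one,
        ENNReal.coe_rpow_of_nonneg _ (by positivity)]

end SubcriticalSetting

end Critical

/-! ### Mass balance from the mass bounds -/

section Balance

variable {X : Type*} [MetricSpace X] [MeasurableSpace X] {μ ν : Measure X} {E : Set X}
  {r₀ s σ p q : ℝ}

theorem UpperMassBoundOn.exists_massBalanceOn (hν : UpperMassBoundOn ν E r₀ σ)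
    (hμ : LowerMassBoundOn μ E r₀ s) (hp : 0 < p) (hq : p < q) :
    ∃ A : ℝ≥0, MassBalanceOn μ ν E p q (σ - s * (q / p)) r₀ A := by
  obtain ⟨C', hC', hμ⟩ := hμ
  obtain ⟨C'', hC'', hν⟩ := hν
  have hq0 : 0 < q := hp.trans hq
  refine ⟨(C'' / C' ^ (q / p)).toNNReal, fun x hx r hr hr' => (hν x hx r hr hr').trans ?_⟩
  have hCp : 0 < C' ^ (q / p) := by positivity
  calc ENNReal.ofReal (C'' * r ^ σ)
      = ENNReal.ofReal (C'' / C' ^ (q / p)) * ENNReal.ofReal (r ^ (σ - s * (q / p))) *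
        ENNReal.ofReal (C' * r ^ s) ^ (q / p) := by
        rw [ENNReal.ofReal_rpow_of_nonneg (by positivity) (by positivity),
          ← ENNReal.ofReal_mul (by positivity), ← ENNReal.ofReal_mul (by positivity),
          Real.mul_rpow hC'.le (by positivity), ← Real.rpow_mul hr.le, Real.rpow_sub hr]
        congr 1
        have : 0 < r ^ (s * (q / p)) := by positivity
        field_simp
    _ ≤ _ := by
        rw [ENNReal.ofReal]
        gcongr
        exact hμ x hx r hr hr'

/-- The lower bound raised to the power q/p − 1 > 0 shows that C'^{1−q/p} r^{s−sq/p} μ(B)^{q/p−1} ≥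
1. Multiplying by μ(B) gives the balance with no upper mass bound. -/
theorem LowerMassBoundOn.exists_massBalanceOn_self (hμ : LowerMassBoundOn μ E r₀ s)
    (hp : 0 < p) (hq : p < q) :
    ∃ A : ℝ≥0, MassBalanceOn μ μ E p q (s - s * (q / p)) r₀ A := by
  obtain ⟨C', hC', hμ⟩ := hμ
  have hκ : 0 ≤ q / p - 1 := by
    have := (one_lt_div hp).2 hq
    linarith
  refine ⟨(C' ^ (1 - q / p)).toNNReal, fun x hx r hr hr' => ?_⟩
  have hsplit : μ (ball x r) ^ (q / p) = μ (ball x r) ^ (q / p - 1) * μ (ball x r) := by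
    conv_lhs => rw [show q / p = (q / p - 1) + 1 by ring]
    rw [ENNReal.rpow_add_of_nonneg _ _ hκ zero_le_one, ENNReal.rpow_one]
  have hone : ENNReal.ofReal (C' ^ (1 - q / p)) * ENNReal.ofReal (r ^ (s - s * (q / p))) *
      ENNReal.ofReal (C' * r ^ s) ^ (q / p - 1) = 1 := by
    rw [ENNReal.ofReal_rpow_of_nonneg (by positivity) hκ, ← ENNReal.ofReal_mul (by positivity),
      ← ENNReal.ofReal_mul (by positivity), Real.mul_rpow hC'.le (by positivity),
      ← Real.rpow_mul hr.le, ← ENNReal.ofReal_one]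
    congr 1
    calc _ = (C' ^ (1 - q / p) * C' ^ (q / p - 1)) *
          (r ^ (s - s * (q / p)) * r ^ (s * (q / p - 1))) := by ring
      _ = 1 := by
        rw [← Real.rpow_add hC', ← Real.rpow_add hr]
        ring_nf
        simp
  calc μ (ball x r) = ENNReal.ofReal (C' ^ (1 - q / p)) * ENNReal.ofReal (r ^ (s - s * (q / p))) *
      ENNReal.ofReal (C' * r ^ s) ^ (q / p - 1) * μ (ball x r) := by rw [hone, one_mul]
    _ ≤ _ := by
        rw [hsplit, ← mul_assoc]
        rw [ENNReal.ofReal]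
        gcongr
        exact hμ x hx r hr hr'

end Balance

/-! ### Assembly of the main theorem -/

theorem EnlargementBoundOn.mono_const {X : Type*} [MetricSpace X] [MeasurableSpace X]
    {ν : Measure X} {E : Set X} {L ρ : ℝ} {D D' : ℝ≥0} (h : EnlargementBoundOn ν E L ρ D)
    (hD : D ≤ D') : EnlargementBoundOn ν E L ρ D' := fun x hx r hr hr' =>
  ⟨(h x hx r hr hr').1, (h x hx r hr hr').2.1.trans (by gcongr), (h x hx r hr hr').2.2⟩

/-- Compactness below, and boundedness up to, the critical exponent, for two measures that are in
balance. -/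
theorem compactEmbedding_and_boundedEmbedding {X : Type*} [MetricSpace X] [MeasurableSpace X]
    [OpensMeasurableSpace X] {μ ν : Measure X} {E : Set X} (hE : TotallyBounded E)
    {p α s σ r₀ lam : ℝ} (hp : 1 ≤ p) (hσ : 0 < σ) (hr₀ : 0 < r₀) (hlam : 1 ≤ lam)
    (hμD : LocallyDoublingOn μ E r₀) (hμs : LowerMassBoundOn μ E r₀ s)
    {Y : Set (X → ℝ)} (hY : Y ⊆ poincareSobolev μ E α p lam r₀)
    {G : (X → ℝ) → (X → ℝ)} (hG : ∀ u ∈ Y, IsPoincareGradient μ E α p lam r₀ u (G u))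
    (hEν : NullMeasurableSet E ν) (hνD : LocallyDoublingOn ν E r₀) (hνR : RatioBoundOn ν E r₀)
    (hbal : ∀ q, p < q → ∃ A : ℝ≥0, MassBalanceOn μ ν E p q (σ - s * (q / p)) r₀ A)
    {N : (X → ℝ) → ℝ≥0∞} (hN : N = normOnE μ ν E p G ∨ N = normOnX μ p G)
    (hNfin : ∀ u ∈ Y, N u < ∞) {q : ℝ} (hq : p < q) :
    (q * (s - α * p) < σ * p → CompactEmbedding μ ν E q Y N) ∧
    (TruncationProperty μ E α p lam r₀ Y G → q * (s - α * p) ≤ σ * p →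
      BoundedEmbedding μ ν E q Y N) := by
  have hp0 : 0 < p := by linarith
  obtain ⟨ρ₁, hρ₁, hρ₁', D₁, hD₁⟩ := hμD.exists_enlargementBoundOn hr₀ 4
  obtain ⟨ρ₂, hρ₂, -, D₂, hD₂⟩ := hνD.exists_enlargementBoundOn hr₀ (6 * lam)
  set ρ := min ρ₁ ρ₂ with hρ_def
  have hρ : 0 < ρ := lt_min hρ₁ hρ₂
  have hρr : ρ ≤ r₀ := (min_le_left _ _).trans hρ₁'
  have hbal' : ∀ q, p < q → ∃ A : ℝ≥0, MassBalanceOn μ ν E p q (σ - s * (q / p)) ρ A := by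
    intro q hq
    obtain ⟨A, hA⟩ := hbal q hq
    exact ⟨A, fun x hx r hr hr' => hA x hx r hr (hr'.trans hρr)⟩
  have hset : ∀ q₁, p < q₁ → q₁ * (s - α * p) < σ * p → ∃ (ε : ℝ) (A : ℝ≥0),
      SubcriticalSetting μ ν E p α lam ρ q₁ (σ - s * (q₁ / p)) ε (max D₁ D₂) A := by
    intro q₁ hq₁ hlt
    obtain ⟨A, hA⟩ := hbal' q₁ hq₁
    have hq₁0 : 0 < q₁ := hp0.trans hq₁
    have hpos : 0 < α * q₁ + (σ - s * (q₁ / p)) := by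
      have : α * q₁ + (σ - s * (q₁ / p)) = (σ * p - q₁ * (s - α * p)) / p := by
        field_simp; ring
      rw [this]
      exact div_pos (by linarith) hp0
    refine ⟨(α * q₁ + (σ - s * (q₁ / p))) / q₁, A,
      { doubling := (hD₁.mono (min_le_left _ _)).mono_const (le_max_left _ _)
        enlarge := (hD₂.mono (min_le_right _ _)).mono_const (le_max_right _ _)
        totallyBounded := hE
        nullMeasurableSet := hEν
        one_le_p := hp
        one_le_lam := hlam
        ρ_pos := hρ
        ε_pos := div_pos hpos hq₁0
        p_lt := hq₁
        balance := hA
        ε_mul := div_mul_cancel₀ _ hq₁0.ne'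
        lower := fun r hr hr' => ?_ }⟩
    obtain ⟨C', hC', hlow⟩ := hμs
    have hrs : 0 < C' * r ^ s := by positivity
    exact ⟨(C' * r ^ s).toNNReal, (Real.toNNReal_pos.2 hrs).ne',
      fun x hx => hlow x hx r hr (hr'.trans hρr)⟩
  have hosc : ∀ u ∈ Y, OscillationBoundOn μ E p α lam ρ 1 u (gradMeasure μ p (G u)) := by
    refine fun u hu => ⟨(hY hu).1, fun x hx r hr hr' => ?_⟩
    have := (hG u hu).2.2.ofReal_le hp hlam hx hr (hr'.trans hρr)
    rwa [nnnorm_one] at this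
  have hNG : ∀ u, eLpNorm (G u) (ENNReal.ofReal p) μ ≤ N u := by
    rcases hN with rfl | rfl <;> exact fun u => le_add_self
  have hmean : ∀ {q₁ β ε : ℝ} {A : ℝ≥0},
      SubcriticalSetting μ ν E p α lam ρ q₁ β ε (max D₁ D₂) A →
      ∀ n : ℕ, ∃ C : ℝ≥0, MeanBoundOn μ ν E Y N (ρ / 2 ^ (n + 1)) C := by
    intro q₁ β ε A S n
    rcases hN with rfl | rfl
    · exact S.exists_meanBoundOn_normOnE hosc n
    · exact S.exists_meanBoundOn_normOnX Y G (n + 1)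
  -- The strict inequality leaves room for the larger weak type exponent q₁.
  have hsub : q * (s - α * p) < σ * p → ∃ q₁, q < q₁ ∧ q₁ * (s - α * p) < σ * p := by
    intro hlt
    have hcont : Tendsto (fun x => x * (s - α * p)) (𝓝[>] q) (𝓝 (q * (s - α * p))) :=
      ((continuous_id.mul continuous_const).tendsto q).mono_left nhdsWithin_le_nhds
    obtain ⟨q₁, h1, h2⟩ := ((hcont.eventually_lt_const hlt).and self_mem_nhdsWithin).exists
    exact ⟨q₁, h2, h1⟩
  refine ⟨fun hlt => ?_, fun hT hle => ?_⟩
  · obtain ⟨q₁, hqq, hlt₁⟩ := hsub hlt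
    obtain ⟨ε, A, S⟩ := hset q₁ (hq.trans hqq) hlt₁
    exact S.compactEmbedding hosc hNG hNfin (hmean S) (hp.trans hq.le) hqq
  · rcases hle.lt_or_eq with hlt | heq
    · obtain ⟨q₁, hqq, hlt₁⟩ := hsub hlt
      obtain ⟨ε, A, S⟩ := hset q₁ (hq.trans hqq) hlt₁
      obtain ⟨C₀, hC₀⟩ := hmean S 0
      have hb := S.exists_eLpNorm_preciseRep_le hosc hNG hC₀ (hp.trans hq.le) hqq
      exact boundedEmbedding_of_forall_le (S.embedsIn_of_forall_le hosc hNG hNfin hb) hNfin hb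
    · have hq0 : 0 < q := hp0.trans hq
      have hpos : 0 < s - α * p := by
        by_contra! hneg
        have : 0 < σ * p := mul_pos hσ hp0
        nlinarith
      -- At the critical q an auxiliary, strictly subcritical exponent in (p,q) still supplies
      -- Lebesgue values, measurability and mean bounds.
      obtain ⟨ε, A, S⟩ := hset ((p + q) / 2) (by linarith) (by
        rw [← heq]; exact mul_lt_mul_of_pos_right (by linarith) hpos)
      obtain ⟨C₀, hC₀⟩ := hmean S 0
      obtain ⟨A', hA'⟩ := hbal' q hq
      obtain ⟨K, hK⟩ := hT
      have hβ : α * q + (σ - s * (q / p)) = 0 := by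
        have : α * q + (σ - s * (q / p)) = (σ * p - q * (s - α * p)) / p := by
          field_simp; ring
        rw [this, heq, sub_self, zero_div]
      have hb := S.exists_eLpNorm_preciseRep_le_of_critical hosc hNG hA' hβ hνR hρr
        (S.radius_pos (0 + 1)) (S.radius_le (0 + 1)) hq
        (fun u hu l k hlk x hx r hr hr' => hK u hu l k hlk x hx r hr
          (hr'.trans ((S.radius_le (0 + 1)).trans hρr))) hC₀
      exact boundedEmbedding_of_forall_le (S.embedsIn_of_forall_le hosc hNG hNfin hb) hNfin hb

theorem mainTheorem5 {X : Type*} [MetricSpace X] [MeasurableSpace X] [OpensMeasurableSpace X]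
    (μ : Measure X) (E : Set X) (hE : TotallyBounded E)
    (p α s r₀ lam : ℝ) (hp : 1 ≤ p) (hα : 0 < α) (hs : 0 < s) (hr₀ : 0 < r₀) (hlam : 1 ≤ lam)
    (hμD : LocallyDoublingOn μ E r₀) (hμs : LowerMassBoundOn μ E r₀ s)
    (Y : Set (X → ℝ)) (hY : Y ⊆ poincareSobolev μ E α p lam r₀)
    (G : (X → ℝ) → (X → ℝ)) (hG : ∀ u ∈ Y, IsPoincareGradient μ E α p lam r₀ u (G u)) :
    -- two measures
    (∀ (ν : Measure X) (σ : ℝ), NullMeasurableSet E ν → 0 < ν E →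
      LocallyDoublingOn ν E r₀ → RatioBoundOn ν E r₀ → UpperMassBoundOn ν E r₀ σ →
      0 < σ → s - α * p < σ →
      ∀ N : (X → ℝ) → ℝ≥0∞, (N = normOnE μ ν E p G ∨ N = normOnX μ p G) →
      (∀ u ∈ Y, N u < ∞) →
      ∀ q : ℝ, p < q →
        (q * (s - α * p) < σ * p → CompactEmbedding μ ν E q Y N) ∧
        (TruncationProperty μ E α p lam r₀ Y G → q * (s - α * p) ≤ σ * p →
          BoundedEmbedding μ ν E q Y N)) ∧
    -- the case of equal measures
    (NullMeasurableSet E μ → 0 < μ E → RatioBoundOn μ E r₀ →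
      ∀ N : (X → ℝ) → ℝ≥0∞, (N = normOnE μ μ E p G ∨ N = normOnX μ p G) →
      (∀ u ∈ Y, N u < ∞) →
      ∀ q : ℝ, p < q →
        (q * (s - α * p) < s * p → CompactEmbedding μ μ E q Y N) ∧
        (TruncationProperty μ E α p lam r₀ Y G → q * (s - α * p) ≤ s * p →
          BoundedEmbedding μ μ E q Y N)) := by
  have hp0 : 0 < p := by linarith
  refine ⟨fun ν σ hEν _ hνD hνR hνσ hσ _ N hN hNfin q hq => ?_, fun hEμ _ hμR N hN hNfin q hq => ?_⟩
  · exact compactEmbedding_and_boundedEmbedding hE hp hσ hr₀ hlam hμD hμs hY hG hEν hνD hνR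
      (fun q hq => hνσ.exists_massBalanceOn hμs hp0 hq) hN hNfin hq
  · exact compactEmbedding_and_boundedEmbedding hE hp hs hr₀ hlam hμD hμs hY hG hEμ hμD hμR
      (fun q hq => hμs.exists_massBalanceOn_self hp0 hq) hN hNfin hq
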